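/- Let $P$ be a nonempty set of $n$ points in the plane in general position (no two points share an $x$- or a $y$-coordinate, no three lie on a line). Write that $p$ dominates $q$ if $p\neq q$, $p_x\ge q_x$ and $p_y\ge q_y$; the Pareto front $\mathrm{pf}(P)$ consists of the points of $P$ that no point of $P$ dominates. Let $R$ be a set of pairwise disjoint axis-aligned rectangles. The universe $\mathbb I_{P,R}$ is the set of all lists $I$ that contain every point of $P$ exactly once and such that, for each $r\in R$, the points of $r\cap P$ appear in $I$ in increasing or decreasing order by $x$- or by $y$-coordinate. A compass function $\kappa$ assigns to each $r\in R$ one of "increasing by $x$", "decreasing by $x$", "increasing by $y$", "decreasing by $y$". For each $\kappa$ fix a linear order $<_L$ ($L=L_\kappa$) on $P$ such that $q<_L p$ whenever $p$ dominates $q$, and such that, for each $r\in R$ that $\kappa$ sorts by $x$ (respectively by $y$) and all $p,q\in P\cap r$, $p_x<q_x$ (respectively $p_y<q_y$) implies $p<_L q$. An ordered normalized downdraft for $\kappa$ is a map $\psi:P\setminus\mathrm{pf}(P)\to P$ together with a total order $\prec$ on each fiber of $\psi$, such that $\psi(p)$ dominates $p$ for all $p$, and for all $r\in R$ and $p,q\in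 r\cap(P\setminus\mathrm{pf}(P))$: if $p<_L q$ then $\psi(p)\le_L\psi(q)$; and if $\psi(p)=\psi(q)$ then $p<_L q\Leftrightarrow p\prec q$. Let $\mathrm{OND}_{\max}(P,R)$ be the maximum over all $\kappa$ of the number of ordered normalized downdrafts for $\kappa$. The Pareto front algorithm, on a list $I'$: if $I'$ is sorted (increasingly or decreasingly, by $x$ or by $y$), report the front of $I'$ and a dominating witness for every other point by a linear scan. Otherwise let $m$ be the median $x$-coordinate in $I'$ (found by deterministic median-of-medians selection), let $q$ be the highest point of $I'$ with $q_x\ge m$, make $q$ the witness of the points of $I'$ that it dominates, recurse on $\{p\in I' : p_y>q_y\}$, report $q$ as a front point, and recurse on $\{p\in I' : p_x>q_x\}$. Its running time is the number of elementary steps (visits of list cells, coordinate comparisons, writes, calls). Then there are absolute constants $C_1,C_2>0$ such that for all such $P$ and $R$, all such choices of the orders $L_\kappa$ for which $\mathrm{OND}_{\max}(P,R)>0$ (so that the quotient below is defined), and every input $I\in\mathbb I_{P,R}$, the algorithm runs on $I$ in at most $$C_1\, n + C_2\,\log_2\frac{|\mathbb I_{P,R}|}{\mathrm{OND}_{\max}(P,R)}$$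 steps; that is, its running time is $O\big(n+\log(|\mathbb I_{P,R}|/\mathrm{OND}_{\max}(P,R))\big)$. -/

import Mathlib

namespace Pareto

/-! ### Points, domination, universes -/

/-- `p` dominates `q`: both coordinates of `p` are at least those of `q`, and `p` is another point. -/
def Dominates (p q : ℝ × ℝ) : Prop := p ≠ q ∧ q.1 ≤ p.1 ∧ q.2 ≤ p.2

/-- No two points share a coordinate and no three points lie on a line. -/
structure GeneralPosition (P : Finset (ℝ × ℝ)) : Prop where
  injOn_x : Set.InjOn Prod.fst (P : Set (ℝ × ℝ))
  injOn_y : Set.InjOn Prod.snd (P : Set (ℝ × ℝ))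
  not_collinear : ∀ p ∈ P, ∀ q ∈ P, ∀ s ∈ P, p ≠ q → p ≠ s → q ≠ s →
    ¬ Collinear ℝ ({p, q, s} : Set (ℝ × ℝ))

/-- `p` lies on the Pareto front of `P`. -/
def OnFront (P : Finset (ℝ × ℝ)) (p : ℝ × ℝ) : Prop := p ∈ P ∧ ∀ q ∈ P, ¬ Dominates q p

/-- An axis-aligned rectangle: a product of two intervals of any kind
(open, closed, half-open, bounded or not). -/
def IsRectangle (r : Set (ℝ × ℝ)) : Prop :=
  ∃ s t : Set ℝ, s.OrdConnected ∧ t.OrdConnected ∧ r = s ×ˢ t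

/-- A region set: pairwise disjoint axis-aligned rectangles. -/
structure IsRegionSet (R : Set (Set (ℝ × ℝ))) : Prop where
  rect : ∀ r ∈ R, IsRectangle r
  disj : R.PairwiseDisjoint id

/-- The four ways in which the points of a region may be sorted. -/
inductive Compass
  | incX
  | decX
  | incY
  | decY

/-- `c.rel p q`: in the order prescribed by `c`, the point `p` comes before `q`. -/
def Compass.rel : Compass → ℝ × ℝ → ℝ × ℝ → Prop
  | .incX, p, q => p.1 < q.1
  | .decX, p, q => q.1 < p.1
  | .incY, p, q => p.2 < q.2
  | .decY, p, q => q.2 < p.2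

/-- The compass value sorts by `x`-coordinate. -/
def Compass.ByX (c : Compass) : Prop := c = .incX ∨ c = .decX

/-- The compass value sorts by `y`-coordinate. -/
def Compass.ByY (c : Compass) : Prop := c = .incY ∨ c = .decY

/-- The input list `I` respects `R`: the points of each region occur in `I` in increasing or
decreasing order of one of the coordinates. -/
def Respects (I : List (ℝ × ℝ)) (R : Set (Set (ℝ × ℝ))) : Prop :=
  ∀ r ∈ R, ∃ c : Compass, I.Pairwise fun p q => p ∈ r → q ∈ r → c.rel p q

/-- The universe of `(P, R)`: all lists that store each point of `P` exactly once
and respect `R`. -/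
def inputs (P : Finset (ℝ × ℝ)) (R : Set (Set (ℝ × ℝ))) : Set (List (ℝ × ℝ)) :=
  {I | I.Nodup ∧ (∀ p, p ∈ I ↔ p ∈ P) ∧ Respects I R}

/-! ### Ordered normalized downdrafts -/

/-- The linear orders (as strict relations) on `P` that extend domination and, in every region,
the coordinate by which `κ` sorts the region. -/
structure IsAdapted (P : Finset (ℝ × ℝ)) (R : Set (Set (ℝ × ℝ))) (κ : R → Compass)
    (L : P → P → Prop) : Prop where
  strictTotal : IsStrictTotalOrder P L
  dom : ∀ p q : P, Dominates p q → L q p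
  byX : ∀ r : R, (κ r).ByX → ∀ p q : P, p.1 ∈ r.1 → q.1 ∈ r.1 → p.1.1 < q.1.1 → L p q
  byY : ∀ r : R, (κ r).ByY → ∀ p q : P, p.1 ∈ r.1 → q.1 ∈ r.1 → p.1.2 < q.1.2 → L p q

/-- The points of `P` that are not on the Pareto front. -/
abbrev NonFront (P : Finset (ℝ × ℝ)) : Type := {p : P // ¬ OnFront P p}

/-- A downdraft maps every non-front point to a point that dominates it. -/
def IsDowndraft (P : Finset (ℝ × ℝ)) (ψ : NonFront P → P) : Prop :=
  ∀ p : NonFront P, Dominates (ψ p) p.1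

/-- A normalized downdraft is a downdraft that is monotone, with respect to `L`,
on every region. -/
def IsNormalizedDowndraft (P : Finset (ℝ × ℝ)) (R : Set (Set (ℝ × ℝ))) (L : P → P → Prop)
    (ψ : NonFront P → P) : Prop :=
  IsDowndraft P ψ ∧ ∀ r ∈ R, ∀ p q : NonFront P, p.1.1 ∈ r → q.1.1 ∈ r →
    L p.1 q.1 → ψ p = ψ q ∨ L (ψ p) (ψ q)

/-- `prec` is a strict total order on each fiber of `ψ`, and relates no points of
different fibers. -/
structure IsFiberOrder {P : Finset (ℝ × ℝ)} (ψ : NonFront P → P)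
    (prec : NonFront P → NonFront P → Prop) : Prop where
  fiber : ∀ p q, prec p q → ψ p = ψ q
  irrefl : ∀ p, ¬ prec p p
  trans : ∀ p q s, prec p q → prec q s → prec p s
  total : ∀ p q, ψ p = ψ q → p ≠ q → prec p q ∨ prec q p

/-- The set of all ordered normalized downdrafts. The compass function enters through the
linear order `L` that is adapted to it. -/
def OND (P : Finset (ℝ × ℝ)) (R : Set (Set (ℝ × ℝ))) (L : P → P → Prop) :
    Set ((NonFront P → P) × (NonFront P → NonFront P → Prop)) :=
  {x | IsNormalizedDowndraft P R L x.1 ∧ IsFiberOrder x.1 x.2 ∧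
    ∀ r ∈ R, ∀ p q : NonFront P, p.1.1 ∈ r → q.1.1 ∈ r → x.1 p = x.1 q →
      (L p.1 q.1 ↔ x.2 p q)}

/-- The maximum, over all compass functions `κ`, of the number of ordered normalized downdrafts,
where `L κ` is the linear order used for `κ`. -/
noncomputable def ONDmax (P : Finset (ℝ × ℝ)) (R : Set (Set (ℝ × ℝ)))
    (L : (R → Compass) → P → P → Prop) : ℕ :=
  ⨆ κ : R → Compass, (OND P R (L κ)).ncard

/-! ### Programs with a step count

A program returns its result with the number of elementary steps it makes. A step is charged for
every list cell that is visited, for every comparison of two coordinates, for every write to the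
output, and for every call; everything else that a call does is a constant amount of
bookkeeping. -/

/-- A result together with the number of steps spent on it. -/
structure Timed (α : Type) where
  val : α
  steps : ℕ

instance : Monad Timed where
  pure a := ⟨a, 0⟩
  bind x f := ⟨(f x.val).val, x.steps + (f x.val).steps⟩

/-- One elementary step. -/
def tick : Timed Unit := ⟨(), 1⟩

/-- Comparison of two reals. -/
noncomputable def ltT (a b : ℝ) : Timed Bool := do
  tick
  return decide (a < b)

def lengthT {α : Type} : List α → Timed ℕ
  | [] => do
    tick
    return 0
  | _ :: l => do
    tick
    let n ← lengthT l
    return n + 1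

def filterT {α : Type} (test : α → Timed Bool) : List α → Timed (List α)
  | [] => do
    tick
    return []
  | a :: l => do
    tick
    let b ← test a
    let l' ← filterT test l
    return if b then a :: l' else l'

/-- Pushes the elements of the first list, one after the other, onto the second. -/
def pushAllT {α : Type} : List α → List α → Timed (List α)
  | [], acc => do
    tick
    return acc
  | a :: l, acc => do
    tick
    pushAllT l (a :: acc)

def reverseT {α : Type} (l : List α) : Timed (List α) := pushAllT l []

/-- The `k`-th entry, counted from `0`. -/
def nthT : List ℝ → ℕ → Timed ℝ
  | [], _ => do
    tick
    return 0
  | a :: _, 0 => do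
    tick
    return a
  | _ :: l, k + 1 => do
    tick
    nthT l k

noncomputable def insertT (a : ℝ) : List ℝ → Timed (List ℝ)
  | [] => do
    tick
    return [a]
  | b :: l => do
    tick
    let c ← ltT b a
    if c then
      let l' ← insertT a l
      return b :: l'
    else
      return a :: b :: l

noncomputable def insertionSortT : List ℝ → Timed (List ℝ)
  | [] => do
    tick
    return []
  | a :: l => do
    tick
    let l' ← insertionSortT l
    insertT a l'

/-- The medians of consecutive groups of five entries; an incomplete last group is skipped. -/
noncomputable def mediansT : List ℝ → Timed (List ℝ)
  | a :: b :: c :: d :: e :: l => do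
    tick
    let s ← insertionSortT [a, b, c, d, e]
    let m ← nthT s 2
    let ms ← mediansT l
    return m :: ms
  | _ => do
    tick
    return []

/-- Selection of the `k`-th smallest entry, counted from `0`, by the median-of-medians method. The
first argument bounds the depth of the recursion; every recursive call is on a strictly shorter
list, so it is never exhausted when it exceeds the length of the list. -/
noncomputable def selectT : ℕ → List ℝ → ℕ → Timed ℝ
  | 0, _, _ => do
    tick
    return 0
  | fuel + 1, l, k => do
    tick
    let n ← lengthT l
    if n ≤ 5 then
      let s ← insertionSortT l
      nthT s k
    else
      let ms ← mediansT l
      let g ← lengthT ms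
      let pivot ← selectT fuel ms (g / 2)
      let lo ← filterT (fun a => ltT a pivot) l
      let hi ← filterT (fun a => ltT pivot a) l
      let nlo ← lengthT lo
      let nhi ← lengthT hi
      if k < nlo then
        selectT fuel lo k
      else if k < n - nhi then
        return pivot
      else
        selectT fuel hi (k - (n - nhi))

/-! ### The Pareto front algorithm -/

/-- A point together with its position in the input list. -/
structure Item where
  idx : ℕ
  x : ℝ
  y : ℝ

/-- The output under construction: the front list, last element first, and the witness array. -/
structure Output where
  front : List ℕ
  witness : ℕ → ℤ

/-- Writes `j` into cell `i` of the witness array. -/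
def setWitnessT (i j : ℕ) (out : Output) : Timed Output := do
  tick
  return { out with witness := Function.update out.witness i (j : ℤ) }

/-- Tests whether each entry is in relation `lt` with the next one. -/
def sortedT (lt : Item → Item → Timed Bool) : List Item → Timed Bool
  | [] => do
    tick
    return true
  | [_] => do
    tick
    return true
  | a :: b :: l => do
    tick
    let c ← lt a b
    if c then sortedT lt (b :: l) else return false

/-- Scans a list that is sorted decreasingly by the coordinate other than `key`, where `best` is the
last front point seen. A new point is on the front if its `key` exceeds that of `best`, and is
otherwise dominated by `best`. The front points found are stacked on `fs`. -/
noncomputable def scanT (key : Item → ℝ) :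
    Item → List Item → List ℕ → Output → Timed (List ℕ × Output)
  | _, [], fs, out => do
    tick
    return (fs, out)
  | best, a :: l, fs, out => do
    tick
    let c ← ltT (key best) (key a)
    if c then
      scanT key a l (a.idx :: fs) out
    else
      let out' ← setWitnessT a.idx best.idx out
      scanT key best l fs out'

/-- Front and witnesses of a list that is sorted decreasingly by `x`. -/
noncomputable def sweepXT (l : List Item) (out : Output) : Timed Output := do
  tick
  match l with
  | [] => return out
  | a :: l' =>
    let (fs, out') ← scanT Item.y a l' [a.idx] out
    let front ← pushAllT fs out'.front
    return { out' with front := front }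

/-- Front and witnesses of a list that is sorted decreasingly by `y`. -/
noncomputable def sweepYT (l : List Item) (out : Output) : Timed Output := do
  tick
  match l with
  | [] => return out
  | a :: l' =>
    let (fs, out') ← scanT Item.x a l' [a.idx] out
    let fs' ← reverseT fs
    let front ← pushAllT fs' out'.front
    return { out' with front := front }

/-- The `x`-coordinates of a list. -/
def xsT : List Item → Timed (List ℝ)
  | [] => do
    tick
    return []
  | a :: l => do
    tick
    let l' ← xsT l
    return a.x :: l'

/-- The entry of largest `y`-coordinate among those with `x`-coordinate at least `m`. -/
noncomputable def highestT (m : ℝ) : List Item → Timed (Option Item)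
  | [] => do
    tick
    return none
  | a :: l => do
    tick
    let best ← highestT m l
    let c ← ltT a.x m
    if c then
      return best
    else
      match best with
      | none => return some a
      | some b =>
        let d ← ltT b.y a.y
        return if d then some a else some b

/-- Records `q` as the witness of all entries, other than `q` itself, that are neither higher than
`q` nor to the right of `q`. -/
noncomputable def assignT (q : Item) : List Item → Output → Timed Output
  | [], out => do
    tick
    return out
  | a :: l, out => do
    tick
    let up ← ltT q.y a.y
    let right ← ltT q.x a.x
    if up || right || a.idx == q.idx then
      assignT q l out
    else
      let out' ← setWitnessT a.idx q.idx out
      assignT q l out'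

/-- The recursive algorithm. A list that is sorted in one of the four ways is handled by a linear
scan. Otherwise the highest point `q` at or to the right of the median `x`-coordinate becomes the
representative, and the algorithm recurses on the points higher than `q` and on the points to the
right of `q`. The first argument bounds the depth of the recursion; both recursive calls are on
strictly shorter lists, so it is never exhausted when it exceeds the length of the list. -/
noncomputable def recurseT : ℕ → List Item → Output → Timed Output
  | 0, _, out => do
    tick
    return out
  | fuel + 1, l, out => do
    tick
    let incX ← sortedT (fun a b => ltT a.x b.x) l
    if incX then
      let l' ← reverseT l
      sweepXT l' out
    else
      let decX ← sortedT (fun a b => ltT b.x a.x) l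
      if decX then
        sweepXT l out
      else
        let incY ← sortedT (fun a b => ltT a.y b.y) l
        if incY then
          let l' ← reverseT l
          sweepYT l' out
        else
          let decY ← sortedT (fun a b => ltT b.y a.y) l
          if decY then
            sweepYT l out
          else
            let xs ← xsT l
            let n ← lengthT xs
            let m ← selectT (n + 1) xs (n / 2)
            let top ← highestT m l
            match top with
            | none => return out
            | some q =>
              let l₁ ← filterT (fun a => ltT q.y a.y) l
              let l₂ ← filterT (fun a => ltT q.x a.x) l
              let out₁ ← assignT q l out
              let out₂ ← recurseT fuel l₁ out₁
              tick
              let out₃ : Output := { out₂ with front := q.idx :: out₂.front }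
              recurseT fuel l₂ out₃

/-- Attaches to each point its position, starting from `i`, and initializes the witness array
(whose cells all hold `-1`); one step for each of the two per point. -/
def prepareT : ℕ → List (ℝ × ℝ) → Timed (List Item)
  | _, [] => do
    tick
    return []
  | i, p :: l => do
    tick
    tick
    let l' ← prepareT (i + 1) l
    return { idx := i, x := p.1, y := p.2 } :: l'

/-- The Pareto front algorithm. On an input list `I` it returns the front list, that is the positions
of the front points by increasing `x`-coordinate, and the witness array. -/
noncomputable def paretoFrontT (I : List (ℝ × ℝ)) : Timed Output := do
  let items ← prepareT 0 I
  let n ← lengthT items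
  let out ← recurseT (n + 1) items { front := [], witness := fun _ => -1 }
  let front ← reverseT out.front
  return { out with front := front }

/-- The running time of the Pareto front algorithm on the input list `I`. -/
noncomputable def runtime (I : List (ℝ × ℝ)) : ℕ := (paretoFrontT I).steps

end Pareto

/-! Record the pivots of a run as a binary tree `t`. The address of a point is the path to the last
subproblem containing it; let `D = t.depthSum P` be the sum of the address lengths and `n = P.card`.
Every call is linear in its list, median selection included, so a run takes `O(n + D)` steps
(`recurseT_le`, `runtime_le`). What remains is `|OND| * (6/5) ^ D ≤ 3840 ^ n * |inputs|` for each
order `L κ` (`ncard_OND_mul_pow_le`); its logarithm bounds `D`.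

Two points share a cell if they lie in a common region; a point outside all regions is alone. Each
cell is split into classes by address and by front membership. Three counts are combined.

Inputs: sorting inside the cells turns any ordering of `P` into an input, so `n! ≤ |inputs| * ∏
|cell|!` (`factorial_le_inputs`).

Downdrafts: an ordered normalized downdraft puts each point into a numbered slot of its witness,
increasingly on each class. Permuting points inside classes yields distinct placements, so `|OND| *
∏ |class|!` is bounded by a count of placements (`ncard_OND_mul_le`). A dominating point lies in
every subproblem of the point it dominates, and a subproblem at depth `d` has at most `n / 2 ^ d`
points. Hence, for each of the at most `4 ^ n` distributions of slots, the inequality of means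
allows at most `(4 * n) ^ n / (3/2) ^ D` placements (`prod_load_le`).

Cells against classes: a list inside one cell is sorted, so only subproblems meeting two cells are
split. Subproblems of equal depth form a staircase, so each side of a rectangle is left by at most
one of them, and the points of a cell have at most eight addresses of each length
(`Valid.card_addr_le`). The multinomial theorem gives `∏ |cell|! * (4/5) ^ D ≤ 80 ^ n * ∏ |class|!`
(`prod_factorial_cell_le`).

Multiplying these bounds and using `n ^ n ≤ 3 ^ n * n!` leaves the factor `(3/2 * 4/5) ^ D = (6/5) ^
D`. -/

namespace Pareto

/-! ### Values and step counts of the elementary programs -/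

@[simp] theorem val_bind {α β : Type} (x : Timed α) (f : α → Timed β) :
    (x >>= f).val = (f x.val).val := rfl

@[simp] theorem steps_bind {α β : Type} (x : Timed α) (f : α → Timed β) :
    (x >>= f).steps = x.steps + (f x.val).steps := rfl

@[simp] theorem val_pure {α : Type} (a : α) : (pure a : Timed α).val = a := rfl

@[simp] theorem steps_pure {α : Type} (a : α) : (pure a : Timed α).steps = 0 := rfl

@[simp] theorem steps_tick : tick.steps = 1 := rfl

@[simp] theorem val_ltT (a b : ℝ) : (ltT a b).val = decide (a < b) := rfl

@[simp] theorem steps_ltT (a b : ℝ) : (ltT a b).steps = 1 := rfl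

@[simp] theorem val_lengthT {α : Type} (l : List α) : (lengthT l).val = l.length := by
  induction l with
  | nil => rfl
  | cons a l ih => simp [lengthT, ih]

@[simp] theorem steps_lengthT {α : Type} (l : List α) : (lengthT l).steps = l.length + 1 := by
  induction l with
  | nil => rfl
  | cons a l ih => simp [lengthT, ih]; omega

@[simp] theorem val_filterT {α : Type} (test : α → Timed Bool) (l : List α) :
    (filterT test l).val = l.filter fun a => (test a).val := by
  induction l with
  | nil => rfl
  | cons a l ih => simp [filterT, ih, List.filter_cons]

theorem steps_filterT {α : Type} (test : α → Timed Bool) (h : ∀ a, (test a).steps = 1)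
    (l : List α) : (filterT test l).steps = 2 * l.length + 1 := by
  induction l with
  | nil => rfl
  | cons a l ih => simp [filterT, ih, h]; omega

@[simp] theorem val_pushAllT {α : Type} (l acc : List α) :
    (pushAllT l acc).val = l.reverse ++ acc := by
  induction l generalizing acc with
  | nil => rfl
  | cons a l ih => simp [pushAllT, ih]

@[simp] theorem steps_pushAllT {α : Type} (l acc : List α) :
    (pushAllT l acc).steps = l.length + 1 := by
  induction l generalizing acc with
  | nil => rfl
  | cons a l ih => simp [pushAllT, ih]; omega

@[simp] theorem val_reverseT {α : Type} (l : List α) : (reverseT l).val = l.reverse := by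
  simp [reverseT]

@[simp] theorem steps_reverseT {α : Type} (l : List α) :
    (reverseT l).steps = l.length + 1 := by
  simp [reverseT]

theorem val_nthT (l : List ℝ) (k : ℕ) : (nthT l k).val = l.getD k 0 := by
  induction l generalizing k with
  | nil => rfl
  | cons a l ih => cases k <;> simp [nthT, ih]

theorem steps_nthT_le (l : List ℝ) (k : ℕ) : (nthT l k).steps ≤ l.length + 1 := by
  induction l generalizing k with
  | nil => rfl
  | cons a l ih =>
    cases k with
    | zero => simp [nthT]
    | succ k => have := ih k; simp [nthT]; omega

theorem val_insertT (a : ℝ) (l : List ℝ) : (insertT a l).val = l.orderedInsert (· ≤ ·) a := by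
  induction l with
  | nil => rfl
  | cons b l ih =>
    by_cases h : b < a
    · simp [insertT, h, ih, not_le.2 h]
    · simp [insertT, h, not_lt.1 h]

theorem steps_insertT_le (a : ℝ) (l : List ℝ) : (insertT a l).steps ≤ 2 * l.length + 1 := by
  induction l with
  | nil => rfl
  | cons b l ih =>
    by_cases h : b < a
    · simp [insertT, h]; omega
    · simp [insertT, h]; omega

theorem val_insertionSortT (l : List ℝ) :
    (insertionSortT l).val = l.insertionSort (· ≤ ·) := by
  induction l with
  | nil => rfl
  | cons a l ih => simp [insertionSortT, ih, val_insertT]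

theorem steps_insertionSortT_le (l : List ℝ) :
    (insertionSortT l).steps ≤ l.length * l.length + l.length + 1 := by
  induction l with
  | nil => simp [insertionSortT]
  | cons a l ih =>
    have h := steps_insertT_le a (insertionSortT l).val
    have h2 : (insertionSortT l).val.length = l.length := by
      rw [val_insertionSortT, List.length_insertionSort]
    rw [h2] at h
    simp only [insertionSortT, steps_bind, steps_tick, List.length_cons]
    nlinarith

theorem steps_setWitnessT (i j : ℕ) (out : Output) : (setWitnessT i j out).steps = 1 := rfl

/-! ### Selection of an order statistic -/

theorem length_mediansT (l : List ℝ) : (mediansT l).val.length = l.length / 5 := by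
  induction l using mediansT.induct with
  | case1 a b c d e l ih => simp [mediansT, ih]; omega
  | case2 l h =>
    rw [mediansT.eq_2 l h]
    have : l.length < 5 := by
      by_contra hl
      match l, hl with
      | a :: b :: c :: d :: e :: l, _ => exact h a b c d e l rfl
      | [], hl | [_], hl | [_, _], hl | [_, _, _], hl | [_, _, _, _], hl => simp at hl
    simp; omega

theorem steps_mediansT_le (l : List ℝ) : (mediansT l).steps ≤ 8 * l.length + 1 := by
  induction l using mediansT.induct with
  | case1 a b c d e l ih =>
    have h1 := steps_insertionSortT_le [a, b, c, d, e]
    have h2 := steps_nthT_le (insertionSortT [a, b, c, d, e]).val 2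
    have h3 : (insertionSortT [a, b, c, d, e]).val.length = 5 := by
      rw [val_insertionSortT, List.length_insertionSort]; rfl
    simp only [mediansT, steps_bind, steps_tick, steps_pure, List.length_cons,
      List.length_nil] at h1 ⊢
    omega
  | case2 l h => rw [mediansT.eq_2 l h]; simp

/-- Of five reals, at least three are on the same side of a bound as their median. -/
theorem countP_le_of_median (a b c d e : ℝ) (p : ℝ → Bool)
    (hp : (∀ x y, x ≤ y → p y → p x) ∨ ∀ x y, x ≤ y → p x → p y)
    (h : p (([a, b, c, d, e].insertionSort (· ≤ ·)).getD 2 0)) :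
    3 ≤ [a, b, c, d, e].countP p := by
  have hperm := List.perm_insertionSort (· ≤ ·) [a, b, c, d, e]
  have hs := List.pairwise_insertionSort (· ≤ ·) [a, b, c, d, e]
  have hl := List.length_insertionSort (· ≤ ·) [a, b, c, d, e]
  rw [← hperm.countP_eq]
  generalize [a, b, c, d, e].insertionSort (· ≤ ·) = s at *
  match s, hl with
  | [s0, s1, s2, s3, s4], _ =>
    simp only [List.getD_cons_succ, List.getD_cons_zero] at h
    simp only [List.pairwise_cons, List.mem_cons, forall_eq_or_imp] at hs
    rcases hp with hp | hp
    · have h0 := hp s0 s2 (by tauto) h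
      have h1 := hp s1 s2 (by tauto) h
      simp only [List.countP_cons, h, h0, h1, if_true]; omega
    · have h0 := hp s2 s3 (by tauto) h
      have h1 := hp s2 s4 (by tauto) h
      simp only [List.countP_cons, h, h0, h1, if_true]; omega

/-- Every median on the given side of the bound brings three entries of its own group to that side;
an incomplete last group can only enlarge the right-hand side. -/
theorem countP_mediansT_le (l : List ℝ) (p : ℝ → Bool)
    (hp : (∀ x y, x ≤ y → p y → p x) ∨ ∀ x y, x ≤ y → p x → p y) :
    3 * (mediansT l).val.countP p ≤ l.countP p := by
  induction l using mediansT.induct with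
  | case1 a b c d e l ih =>
    have h := countP_le_of_median a b c d e p hp
    have h2 : (a :: b :: c :: d :: e :: l).countP p
        = [a, b, c, d, e].countP p + l.countP p := by
      rw [← List.countP_append]; rfl
    rw [h2]
    simp only [mediansT, val_bind, val_pure, val_nthT, val_insertionSortT]
    rw [List.countP_cons (l := (mediansT l).val)]
    split_ifs with hq
    · have := h hq; omega
    · omega
  | case2 l h => rw [mediansT.eq_2 l h]; simp

/-- `v` is the entry of index `k` in the sorted version of `l`. -/
structure IsOrderStat (l : List ℝ) (k : ℕ) (v : ℝ) : Prop where
  lt : l.countP (fun a => decide (a < v)) ≤ k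
  le : k < l.countP fun a => decide (a ≤ v)

theorem isOrderStat_insertionSort (l : List ℝ) {k : ℕ} (hk : k < l.length) :
    IsOrderStat l k ((l.insertionSort (· ≤ ·)).getD k 0) := by
  have hperm := List.perm_insertionSort (· ≤ ·) l
  have hs := List.pairwise_insertionSort (· ≤ ·) l
  have hl := List.length_insertionSort (· ≤ ·) l
  generalize l.insertionSort (· ≤ ·) = s at *
  rw [← hl] at hk
  rw [List.getD_eq_getElem _ _ hk]
  have hsplit : s = s.take k ++ s[k] :: s.drop (k + 1) := by
    rw [← List.drop_eq_getElem_cons hk, List.take_append_drop]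
  have htl : (s.take k).length = k := by simp; omega
  generalize s[k] = v at *
  rw [hsplit, List.pairwise_append, List.pairwise_cons] at hs
  obtain ⟨-, ⟨h1, -⟩, h2⟩ := hs
  constructor
  · rw [← hperm.countP_eq, hsplit, List.countP_append, List.countP_cons]
    have : (s.drop (k + 1)).countP (fun a => decide (a < v)) = 0 := by
      rw [List.countP_eq_zero]; intro a ha; simpa using h1 a ha
    have := List.countP_le_length (p := fun a => decide (a < v)) (l := s.take k)
    simp; omega
  · rw [← hperm.countP_eq, hsplit, List.countP_append, List.countP_cons]
    have : (s.take k).countP (fun a => decide (a ≤ v)) = (s.take k).length := by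
      rw [List.countP_eq_length]; intro a ha; simpa using h2 a ha v (by simp)
    simp; omega

theorem countP_lt_add_countP_ge (l : List ℝ) (v : ℝ) :
    l.countP (fun a => decide (a < v)) + l.countP (fun a => decide (v ≤ a)) = l.length := by
  have := List.length_eq_countP_add_countP (fun a => decide (a < v)) (l := l)
  simpa using this.symm

theorem countP_le_add_countP_gt (l : List ℝ) (v : ℝ) :
    l.countP (fun a => decide (a ≤ v)) + l.countP (fun a => decide (v < a)) = l.length := by
  have := List.length_eq_countP_add_countP (fun a => decide (a ≤ v)) (l := l)
  simpa using this.symm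

theorem IsOrderStat.of_lo {l : List ℝ} {k : ℕ} {v p : ℝ} (hk : k < l.countP fun a => decide (a < p))
    (h : IsOrderStat (l.filter fun a => decide (a < p)) k v) : IsOrderStat l k v := by
  have hvp : v < p := by
    by_contra hv
    have h1 := h.lt
    rw [List.countP_filter] at h1
    have : l.countP (fun a => decide (a < p))
        ≤ l.countP (fun a => decide (a < v) && decide (a < p)) := by
      apply List.countP_mono_left
      intro a _ ha
      simp only [decide_eq_true_eq, Bool.and_eq_true] at ha ⊢
      exact ⟨by linarith, ha⟩
    omega
  constructor
  · have h1 := h.lt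
    rw [List.countP_filter] at h1
    refine le_trans (List.countP_mono_left ?_) h1
    intro a _ ha
    simp only [decide_eq_true_eq, Bool.and_eq_true] at ha ⊢
    exact ⟨ha, by linarith⟩
  · refine lt_of_lt_of_le h.le ?_
    rw [List.countP_filter]
    apply List.countP_mono_left
    intro a _ ha
    simp only [decide_eq_true_eq, Bool.and_eq_true] at ha ⊢
    exact ha.1

theorem IsOrderStat.of_hi {l : List ℝ} {k : ℕ} {v p : ℝ}
    (hk : l.countP (fun a => decide (a ≤ p)) ≤ k)
    (h : IsOrderStat (l.filter fun a => decide (p < a))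
      (k - l.countP fun a => decide (a ≤ p)) v) : IsOrderStat l k v := by
  have hpv : p < v := by
    by_contra hv
    have h1 := h.le
    rw [List.countP_filter] at h1
    have : l.countP (fun a => decide (a ≤ v) && decide (p < a)) = 0 := by
      rw [List.countP_eq_zero]
      intro a _
      simp only [decide_eq_true_eq, Bool.and_eq_true, not_and]
      intro h; linarith
    omega
  have key : ∀ q : ℝ → Bool, (∀ a, a ≤ p → q a) → l.countP q =
      l.countP (fun a => decide (a ≤ p)) + (l.filter fun a => decide (p < a)).countP q := by
    intro q hq
    clear h hk
    induction l with
    | nil => rfl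
    | cons a l ih =>
      by_cases hap : a ≤ p
      · simp [hap, hq a hap, not_lt.2 hap, ih]; omega
      · by_cases hqa : q a
        · simp [hap, not_le.1 hap, ih, hqa]; omega
        · simp [hap, not_le.1 hap, ih, hqa]
  constructor
  · have := h.lt
    rw [key _ fun a ha => by simpa using lt_of_le_of_lt ha hpv]; omega
  · have := h.le
    rw [key _ fun a ha => by simpa using ha.trans hpv.le]; omega

/-- At least about half of the `n / 5` medians lie on either weak side of the pivot, each with three
entries of its group, so either recursive list misses about `3n / 10` entries. The recursive calls
act on about `n / 5 + 7n / 10` entries in all, and the remaining tenth of the budget pays for the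
scans. -/
theorem selectT_spec (fuel : ℕ) (l : List ℝ) (k : ℕ) (hf : l.length < fuel) (hk : k < l.length) :
    IsOrderStat l k (selectT fuel l k).val ∧ (selectT fuel l k).steps ≤ 600 * l.length := by
  induction fuel generalizing l k with
  | zero => omega
  | succ fuel ih =>
    by_cases h5 : l.length ≤ 5
    · have hval : (selectT (fuel + 1) l k).val = (l.insertionSort (· ≤ ·)).getD k 0 := by
        simp [selectT, h5, val_nthT, val_insertionSortT]
      have h1 := steps_insertionSortT_le l
      have h2 := steps_nthT_le (insertionSortT l).val k
      have h3 : (insertionSortT l).val.length = l.length := by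
        rw [val_insertionSortT, List.length_insertionSort]
      refine ⟨hval ▸ isOrderStat_insertionSort l hk, ?_⟩
      simp only [selectT, steps_bind, steps_tick, val_lengthT, steps_lengthT, h5, if_true]
      nlinarith
    · set ms := (mediansT l).val with hms
      have hmsl : ms.length = l.length / 5 := length_mediansT l
      obtain ⟨hp, hpt⟩ := ih ms (ms.length / 2) (by omega) (by omega)
      set p := (selectT fuel ms (ms.length / 2)).val with hpdef
      have hlo : (l.filter fun a => decide (a < p)).length
          = l.countP fun a => decide (a < p) := List.countP_eq_length_filter.symm
      have hhi : (l.filter fun a => decide (p < a)).length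
          = l.countP fun a => decide (p < a) := List.countP_eq_length_filter.symm
      have hc1 := countP_lt_add_countP_ge l p
      have hc2 := countP_le_add_countP_gt l p
      have hc3 := countP_lt_add_countP_ge ms p
      have hm1 := countP_mediansT_le l (fun a => decide (a ≤ p)) (Or.inl fun x y hxy hy => by
        simp only [decide_eq_true_eq] at hy ⊢; linarith)
      have hm2 := countP_mediansT_le l (fun a => decide (p ≤ a)) (Or.inr fun x y hxy hy => by
        simp only [decide_eq_true_eq] at hy ⊢; linarith)
      rw [← hms] at hm1 hm2
      have hp1 := hp.lt
      have hp2 := hp.le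
      have hsteps := steps_mediansT_le l
      have hnhi : l.length - (l.countP fun a => decide (p < a))
          = l.countP fun a => decide (a ≤ p) := by omega
      -- `ms.length` and `l.length - 3 * (ms.length - ms.length / 2)` bound the lengths passed to
      -- the two recursive calls. The factor 600 is large enough to survive the rounding in short
      -- lists, from length 6 on.
      have hb : 600 * (ms.length + (l.length - 3 * (ms.length - ms.length / 2)))
          + (13 * l.length + l.length + 20) ≤ 600 * l.length := by omega
      have e : selectT (fuel + 1) l k = (do
        tick
        let n ← lengthT l
        if n ≤ 5 then
          let s ← insertionSortT l
          nthT s k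
        else
          let ms ← mediansT l
          let g ← lengthT ms
          let pivot ← selectT fuel ms (g / 2)
          let lo ← filterT (fun a => ltT a pivot) l
          let hi ← filterT (fun a => ltT pivot a) l
          let nlo ← lengthT lo
          let nhi ← lengthT hi
          if k < nlo then
            selectT fuel lo k
          else if k < n - nhi then
            return pivot
          else
            selectT fuel hi (k - (n - nhi))) := rfl
      rw [e]
      simp only [steps_bind, val_bind, steps_tick, val_lengthT, steps_lengthT, h5, if_false,
        val_filterT, steps_filterT _ (fun a => steps_ltT _ _), val_ltT, ← hms, ← hpdef, hlo, hhi,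
        hnhi]
      by_cases hk1 : k < l.countP fun a => decide (a < p)
      · obtain ⟨r1, r2⟩ := ih (l.filter fun a => decide (a < p)) k (by omega) (by omega)
        simp only [hk1, if_true]
        refine ⟨r1.of_lo hk1, ?_⟩
        rw [hlo] at r2
        omega
      · by_cases hk2 : k < l.countP fun a => decide (a ≤ p)
        · simp only [hk1, hk2, if_true, if_false, val_pure, steps_pure]
          refine ⟨⟨by omega, hk2⟩, ?_⟩
          omega
        · obtain ⟨r1, r2⟩ := ih (l.filter fun a => decide (p < a))
            (k - l.countP fun a => decide (a ≤ p)) (by omega) (by omega)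
          simp only [hk1, hk2, if_false]
          refine ⟨r1.of_hi (by omega), ?_⟩
          rw [hhi] at r2
          omega

/-! ### The linear scans of the Pareto front algorithm -/

@[simp] theorem steps_ite {α : Type} (c : Prop) [Decidable c] (x y : Timed α) :
    (if c then x else y).steps = if c then x.steps else y.steps := by split_ifs <;> rfl

@[simp] theorem val_ite {α : Type} (c : Prop) [Decidable c] (x y : Timed α) :
    (if c then x else y).val = if c then x.val else y.val := by split_ifs <;> rfl

theorem steps_sortedT_le (lt : Item → Item → Timed Bool) (h : ∀ a b, (lt a b).steps = 1)
    (l : List Item) : (sortedT lt l).steps ≤ 2 * l.length + 1 := by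
  induction l using sortedT.induct with
  | case1 => simp [sortedT]
  | case2 a => simp [sortedT]
  | case3 a b l ih =>
    simp only [sortedT, steps_bind, steps_tick, h, steps_ite, steps_pure, List.length_cons] at ih ⊢
    split_ifs <;> omega

theorem val_sortedT_of_pairwise (lt : Item → Item → Timed Bool) (l : List Item)
    (h : l.Pairwise fun a b => (lt a b).val = true) : (sortedT lt l).val = true := by
  induction l using sortedT.induct with
  | case1 => rfl
  | case2 a => rfl
  | case3 a b l ih =>
    rw [List.pairwise_cons] at h
    simp [sortedT, h.1 b (by simp), ih h.2]

theorem scanT_le (key : Item → ℝ) (best : Item) (l : List Item) (fs : List ℕ) (out : Output) :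
    (scanT key best l fs out).steps ≤ 3 * l.length + 1 ∧
      (scanT key best l fs out).val.1.length ≤ fs.length + l.length ∧
      (scanT key best l fs out).val.2.front = out.front := by
  induction l generalizing best fs out with
  | nil => simp [scanT]
  | cons a l ih =>
    by_cases hc : key best < key a
    · have := ih a (a.idx :: fs) out
      simp [scanT, hc] at this ⊢
      exact ⟨by omega, by omega, this.2.2⟩
    · have := ih best fs (setWitnessT a.idx best.idx out).val
      simp [scanT, hc, steps_setWitnessT] at this ⊢
      exact ⟨by omega, by omega, this.2.2.trans rfl⟩

theorem sweepXT_le (l : List Item) (out : Output) :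
    (sweepXT l out).val.front.length ≤ out.front.length + l.length ∧
      (sweepXT l out).steps ≤ 4 * l.length + 4 := by
  cases l with
  | nil => simp [sweepXT]
  | cons a l =>
    have := scanT_le Item.y a l [a.idx] out
    simp [sweepXT] at this ⊢
    rw [this.2.2]
    omega

theorem sweepYT_le (l : List Item) (out : Output) :
    (sweepYT l out).val.front.length ≤ out.front.length + l.length ∧
      (sweepYT l out).steps ≤ 5 * l.length + 5 := by
  cases l with
  | nil => simp [sweepYT]
  | cons a l =>
    have := scanT_le Item.x a l [a.idx] out
    simp [sweepYT] at this ⊢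
    rw [this.2.2]
    omega

@[simp] theorem val_xsT (l : List Item) : (xsT l).val = l.map Item.x := by
  induction l with
  | nil => rfl
  | cons a l ih => simp [xsT, ih]

@[simp] theorem steps_xsT (l : List Item) : (xsT l).steps = l.length + 1 := by
  induction l with
  | nil => rfl
  | cons a l ih => simp [xsT, ih]; omega

theorem steps_highestT_le (m : ℝ) (l : List Item) :
    (highestT m l).steps ≤ 3 * l.length + 1 := by
  induction l with
  | nil => simp [highestT]
  | cons a l ih =>
    by_cases hc : a.x < m
    · simp [highestT, hc]
      omega
    · cases h : (highestT m l).val <;> simp [highestT, hc, h] <;> omega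

theorem val_highestT (m : ℝ) (l : List Item) :
    match (highestT m l).val with
    | none => ∀ a ∈ l, a.x < m
    | some q => q ∈ l ∧ m ≤ q.x ∧ ∀ a ∈ l, m ≤ a.x → a.y ≤ q.y := by
  induction l with
  | nil => simp [highestT]
  | cons a l ih =>
    by_cases hc : a.x < m
    · simp only [highestT, val_bind, val_ltT, hc, decide_true, if_true, val_pure]
      revert ih
      cases (highestT m l).val with
      | none => simpa using fun h => ⟨hc, h⟩
      | some q =>
        intro ih
        simp only [List.mem_cons, forall_eq_or_imp]
        exact ⟨Or.inr ih.1, ih.2.1, fun h => absurd hc (not_lt.2 h), ih.2.2⟩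
    · simp only [highestT, val_bind, val_ltT, hc, decide_false, Bool.false_eq_true, if_false]
      revert ih
      cases (highestT m l).val with
      | none =>
        intro ih
        simp only [val_pure, List.mem_cons, forall_eq_or_imp]
        exact ⟨Or.inl trivial, not_lt.1 hc, fun _ => le_rfl, fun b hb h => absurd (ih b hb) (not_lt.2 h)⟩
      | some q =>
        intro ih
        by_cases hd : q.y < a.y
        · simp only [val_bind, val_ltT, hd, decide_true, if_true, val_pure, List.mem_cons,
            forall_eq_or_imp]
          exact ⟨Or.inl trivial, not_lt.1 hc, fun _ => le_rfl,
            fun b hb h => (ih.2.2 b hb h).trans hd.le⟩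
        · simp only [val_bind, val_ltT, hd, decide_false, Bool.false_eq_true, if_false, val_pure,
            List.mem_cons, forall_eq_or_imp]
          exact ⟨Or.inr ih.1, ih.2.1, fun _ => not_lt.1 hd, ih.2.2⟩

theorem front_assignT (q : Item) (l : List Item) (out : Output) :
    (assignT q l out).val.front = out.front := by
  induction l generalizing out with
  | nil => rfl
  | cons a l ih =>
    simp only [assignT, val_bind, val_ite]
    split_ifs
    · exact ih out
    · exact (ih _).trans rfl

theorem steps_assignT_le (q : Item) (l : List Item) (out : Output) :
    (assignT q l out).steps ≤ 4 * l.length + 1 := by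
  induction l generalizing out with
  | nil => simp [assignT]
  | cons a l ih =>
    simp only [assignT, steps_bind, steps_tick, steps_ltT, steps_ite, steps_setWitnessT,
      List.length_cons]
    have h1 := ih out
    have h2 := ih (setWitnessT a.idx q.idx out).val
    split_ifs <;> omega

/-! ### Pivot trees -/

/-- The tree of the pivots used by the recursion. -/
inductive PivotTree
  | leaf
  | node (q : ℝ × ℝ) (up right : PivotTree)

/-- The path from the root to the last subproblem that contains the point `s`; `false` stands for
the points above a pivot and `true` for those to the right of a pivot. -/
noncomputable def PivotTree.addr : PivotTree → ℝ × ℝ → List Bool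
  | .leaf, _ => []
  | .node q a b, s =>
    if q.2 < s.2 then false :: a.addr s else if q.1 < s.1 then true :: b.addr s else []

/-- The pivots of the tree halve the subproblems of `S`, no point is both above and to the right of
a pivot, and only subproblems that meet two classes of `cl` are split. -/
def PivotTree.Valid {γ : Type*} (cl : ℝ × ℝ → γ) : PivotTree → Finset (ℝ × ℝ) → Prop
  | .leaf, _ => True
  | .node q a b, S =>
    (∃ s ∈ S, ∃ t ∈ S, cl s ≠ cl t) ∧ (∀ s ∈ S, q.2 < s.2 → ¬ q.1 < s.1) ∧
      2 * (S.filter fun s => q.2 < s.2).card ≤ S.card ∧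
      2 * (S.filter fun s => q.1 < s.1).card ≤ S.card ∧
      a.Valid cl (S.filter fun s => q.2 < s.2) ∧ b.Valid cl (S.filter fun s => q.1 < s.1)

/-- The point stored in an item. -/
def Item.pt (a : Item) : ℝ × ℝ := (a.x, a.y)

/-- The points of a list of items. -/
noncomputable def points (l : List Item) : Finset (ℝ × ℝ) := (l.map Item.pt).toFinset

/-- The list is sorted by the coordinate and in the direction prescribed by some compass value. -/
def IsSorted (l : List Item) : Prop :=
  ∃ c : Compass, l.Pairwise fun a b => c.rel a.pt b.pt

/-- Each sublist whose points all lie in one class is sorted. -/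
def SortedOnClasses {γ : Type*} (cl : ℝ × ℝ → γ) (l : List Item) : Prop :=
  ∀ l', l'.Sublist l → (∀ a ∈ l', ∀ b ∈ l', cl a.pt = cl b.pt) → IsSorted l'

theorem mem_points {l : List Item} {s : ℝ × ℝ} : s ∈ points l ↔ ∃ a ∈ l, a.pt = s := by
  simp [points]

theorem points_filter (l : List Item) (p : ℝ × ℝ → Prop) [DecidablePred p] :
    points (l.filter fun a => decide (p a.pt)) = (points l).filter p := by
  ext s
  simp only [mem_points, Finset.mem_filter, List.mem_filter, decide_eq_true_eq]
  constructor
  · rintro ⟨a, ⟨h1, h2⟩, rfl⟩; exact ⟨⟨a, h1, rfl⟩, h2⟩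
  · rintro ⟨⟨a, h1, rfl⟩, h2⟩; exact ⟨a, ⟨h1, h2⟩, rfl⟩

theorem card_points {l : List Item} (h : (l.map Item.pt).Nodup) : (points l).card = l.length := by
  rw [points, List.toFinset_card_of_nodup h, List.length_map]

/-- The sum over `S` of the numbers of subproblems that contain a point. -/
noncomputable def PivotTree.size (t : PivotTree) (S : Finset (ℝ × ℝ)) : ℕ :=
  ∑ s ∈ S, ((t.addr s).length + 1)

theorem PivotTree.size_node (q : ℝ × ℝ) (a b : PivotTree) (S : Finset (ℝ × ℝ))
    (h : ∀ s ∈ S, q.2 < s.2 → ¬ q.1 < s.1) :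
    (PivotTree.node q a b).size S = S.card + a.size (S.filter fun s => q.2 < s.2)
      + b.size (S.filter fun s => q.1 < s.1) := by
  simp only [PivotTree.size]
  rw [Finset.sum_filter, Finset.sum_filter, Finset.card_eq_sum_ones, ← Finset.sum_add_distrib,
    ← Finset.sum_add_distrib]
  refine Finset.sum_congr rfl fun s hs => ?_
  by_cases h1 : q.2 < s.2
  · simp [addr, h1, h s hs h1]; omega
  · by_cases h2 : q.1 < s.1
    · simp [addr, h1, h2]; omega
    · simp [addr, h1, h2]

/-- The points above the highest point `q` to the right of the median lie to the left of the
median; these and the points to the right of `q` are at most half of all points. -/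
theorem halving {l : List Item} {m : ℝ} {q : Item}
    (hm : IsOrderStat (l.map Item.x) (l.length / 2) m)
    (hqm : m ≤ q.x) (hq : ∀ a ∈ l, m ≤ a.x → a.y ≤ q.y) :
    2 * (l.filter fun a => decide (q.y < a.y)).length ≤ l.length ∧
      2 * (l.filter fun a => decide (q.x < a.x)).length ≤ l.length := by
  have h1 := hm.lt
  have h2 := countP_le_add_countP_gt (l.map Item.x) m
  have h3 := hm.le
  rw [List.length_map] at h2
  rw [List.countP_map] at h1 h2 h3
  rw [List.countP_map] at h2
  rw [← List.countP_eq_length_filter, ← List.countP_eq_length_filter]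
  have e1 : l.countP (fun a => decide (q.y < a.y))
      ≤ l.countP ((fun a => decide (a < m)) ∘ Item.x) := by
    apply List.countP_mono_left
    intro a ha h
    simp only [decide_eq_true_eq, Function.comp] at h ⊢
    by_contra hc
    linarith [hq a ha (not_lt.1 hc)]
  have e2 : l.countP (fun a => decide (q.x < a.x))
      ≤ l.countP ((fun a => decide (m < a)) ∘ Item.x) := by
    apply List.countP_mono_left
    intro a ha h
    simp only [decide_eq_true_eq, Function.comp] at h ⊢
    linarith
  omega

/-- Summing the list lengths over all calls counts each point once per subproblem containing it,
which is `t.size`. The additive 20 pays for calls on empty lists, whose size is 0; a node has a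
nonempty list and absorbs the 20s of its two subcalls. The length of the front list is tracked
because of its final reversal. -/
theorem recurseT_le {γ : Type*} (cl : ℝ × ℝ → γ) (fuel : ℕ) (l : List Item) (out : Output)
    (hf : l.length < fuel) (hl : (l.map Item.pt).Nodup) (hs : SortedOnClasses cl l) :
    ∃ t : PivotTree, t.Valid cl (points l) ∧
      (recurseT fuel l out).val.front.length ≤ out.front.length + t.size (points l) ∧
      (recurseT fuel l out).steps ≤ 1000 * t.size (points l) + 20 := by
  induction fuel generalizing l out with
  | zero => omega
  | succ fuel ih =>
    have hsz : PivotTree.leaf.size (points l) = l.length := by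
      simp [PivotTree.size, PivotTree.addr, card_points hl]
    set s1 := sortedT (fun a b => ltT a.x b.x) l with hs1
    set s2 := sortedT (fun a b => ltT b.x a.x) l with hs2
    set s3 := sortedT (fun a b => ltT a.y b.y) l with hs3
    set s4 := sortedT (fun a b => ltT b.y a.y) l with hs4
    have g1 : s1.steps ≤ 2 * l.length + 1 := steps_sortedT_le _ (fun _ _ => rfl) l
    have g2 : s2.steps ≤ 2 * l.length + 1 := steps_sortedT_le _ (fun _ _ => rfl) l
    have g3 : s3.steps ≤ 2 * l.length + 1 := steps_sortedT_le _ (fun _ _ => rfl) l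
    have g4 : s4.steps ≤ 2 * l.length + 1 := steps_sortedT_le _ (fun _ _ => rfl) l
    have k1 := sweepXT_le l out
    have k2 := sweepXT_le l.reverse out
    have k3 := sweepYT_le l out
    have k4 := sweepYT_le l.reverse out
    rw [List.length_reverse] at k2 k4
    unfold recurseT
    simp only [steps_bind, val_bind, steps_tick, ← hs1, ← hs2, ← hs3, ← hs4, steps_ite, val_ite,
      val_reverseT, steps_reverseT]
    by_cases c1 : s1.val = true
    · refine ⟨.leaf, trivial, ?_, ?_⟩ <;>
      (rw [hsz]; simp only [c1, if_true]; omega)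
    by_cases c2 : s2.val = true
    · refine ⟨.leaf, trivial, ?_, ?_⟩ <;>
      (rw [hsz]; simp only [c1, c2, if_true, if_false, Bool.false_eq_true]; omega)
    by_cases c3 : s3.val = true
    · refine ⟨.leaf, trivial, ?_, ?_⟩ <;>
      (rw [hsz]; simp only [c1, c2, c3, if_true, if_false, Bool.false_eq_true]; omega)
    by_cases c4 : s4.val = true
    · refine ⟨.leaf, trivial, ?_, ?_⟩ <;>
      (rw [hsz]; simp only [c1, c2, c3, c4, if_true, if_false, Bool.false_eq_true]; omega)
    have hns : ¬ IsSorted l := by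
      rintro ⟨c, hc⟩
      cases c
      · exact c1 (val_sortedT_of_pairwise _ l (hc.imp fun h => by simpa [Compass.rel, Item.pt] using h))
      · exact c2 (val_sortedT_of_pairwise _ l (hc.imp fun h => by simpa [Compass.rel, Item.pt] using h))
      · exact c3 (val_sortedT_of_pairwise _ l (hc.imp fun h => by simpa [Compass.rel, Item.pt] using h))
      · exact c4 (val_sortedT_of_pairwise _ l (hc.imp fun h => by simpa [Compass.rel, Item.pt] using h))
    have hpos : 0 < l.length := by
      rw [List.length_pos_iff]
      rintro rfl
      exact hns ⟨.incX, List.Pairwise.nil⟩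
    -- An unsorted list cannot lie within one class, so every split subproblem is mixed. This is the
    -- only place where the order of the input matters.
    have hmix : ∃ s ∈ points l, ∃ t ∈ points l, cl s ≠ cl t := by
      by_contra hcon
      push Not at hcon
      exact hns (hs l (List.Sublist.refl l) fun a ha b hb =>
        hcon _ (mem_points.2 ⟨a, ha, rfl⟩) _ (mem_points.2 ⟨b, hb, rfl⟩))
    simp only [c1, c2, c3, c4, if_false, Bool.false_eq_true, val_xsT, steps_xsT, val_lengthT, steps_lengthT,
      List.length_map]
    obtain ⟨hm, hmt⟩ := selectT_spec (l.length + 1) (l.map Item.x) (l.length / 2) (by simp)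
      (by simp; omega)
    rw [List.length_map] at hmt
    set m := (selectT (l.length + 1) (l.map Item.x) (l.length / 2)).val with hmdef
    have ht := steps_highestT_le m l
    have hv := val_highestT m l
    revert hv
    cases (highestT m l).val with
    -- The median is an entry of the list, so this case never occurs; the linear bound holds for it
    -- all the same.
    | none =>
      intro _
      refine ⟨.leaf, trivial, ?_, ?_⟩ <;>
      (rw [hsz]; simp only [steps_pure, val_pure]; omega)
    | some q =>
      rintro ⟨-, hqm, hq⟩
      obtain ⟨hh1, hh2⟩ := halving hm hqm hq
      have ha := steps_assignT_le q l out
      simp only [steps_bind, val_filterT, steps_filterT _ (fun a => steps_ltT _ _), val_ltT,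
        steps_tick, val_bind]
      clear hs1 hs2 hs3 hs4
      set l1 := l.filter fun a => decide (q.y < a.y) with hl1
      set l2 := l.filter fun a => decide (q.x < a.x) with hl2
      have f1 : l1.Sublist l := List.filter_sublist
      have f2 : l2.Sublist l := List.filter_sublist
      obtain ⟨t1, v1, u1, r1⟩ := ih l1 (assignT q l out).val (by omega) (hl.sublist (f1.map _))
        fun l' hl' => hs l' (hl'.trans f1)
      obtain ⟨t2, v2, u2, r2⟩ := ih l2
        ⟨q.idx :: (recurseT fuel l1 (assignT q l out).val).val.front,
          (recurseT fuel l1 (assignT q l out).val).val.witness⟩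
        (by omega) (hl.sublist (f2.map _)) fun l' hl' => hs l' (hl'.trans f2)
      have p1 : points l1 = (points l).filter fun s => q.pt.2 < s.2 :=
        points_filter l fun s => q.pt.2 < s.2
      have p2 : points l2 = (points l).filter fun s => q.pt.1 < s.1 :=
        points_filter l fun s => q.pt.1 < s.1
      have hd : ∀ s ∈ points l, q.pt.2 < s.2 → ¬ q.pt.1 < s.1 := by
        intro s hs' h1 h2
        obtain ⟨a, ha, rfl⟩ := mem_points.1 hs'
        have := hq a ha (hqm.trans (le_of_lt h2))
        exact absurd h1 (not_lt.2 this)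
      refine ⟨.node q.pt t1 t2, ⟨hmix, hd, ?_, ?_, p1 ▸ v1, p2 ▸ v2⟩, ?_, ?_⟩
      · rw [← p1, card_points (hl.sublist (f1.map _)), card_points hl]; exact hh1
      · rw [← p2, card_points (hl.sublist (f2.map _)), card_points hl]; exact hh2
      · rw [PivotTree.size_node _ _ _ _ hd, ← p1, ← p2, card_points hl]
        rw [front_assignT] at u1
        rw [List.length_cons] at u2
        omega
      · rw [PivotTree.size_node _ _ _ _ hd, ← p1, ← p2, card_points hl]
        omega

theorem val_prepareT (i : ℕ) (I : List (ℝ × ℝ)) : ((prepareT i I).val).map Item.pt = I := by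
  induction I generalizing i with
  | nil => rfl
  | cons p I ih => simp [prepareT, ih, Item.pt]

theorem steps_prepareT_le (i : ℕ) (I : List (ℝ × ℝ)) :
    (prepareT i I).steps ≤ 3 * I.length + 1 := by
  induction I generalizing i with
  | nil => simp [prepareT]
  | cons p I ih => have := ih (i + 1); simp [prepareT] at this ⊢; omega

theorem runtime_le {γ : Type*} (cl : ℝ × ℝ → γ) (I : List (ℝ × ℝ)) (hI : I.Nodup)
    (hs : ∀ l : List (ℝ × ℝ), l.Sublist I → (∀ p ∈ l, ∀ q ∈ l, cl p = cl q) →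
      ∃ c : Compass, l.Pairwise c.rel) :
    ∃ t : PivotTree, t.Valid cl I.toFinset ∧
      runtime I ≤ 1010 * t.size I.toFinset + 30 := by
  have hp := val_prepareT 0 I
  have hst := steps_prepareT_le 0 I
  set items := (prepareT 0 I).val with hitems
  have hpts : points items = I.toFinset := by rw [points, hp]
  obtain ⟨t, hv, h1, h2⟩ := recurseT_le cl (items.length + 1) items ⟨[], fun _ => -1⟩
    (Nat.lt_succ_self _) (hp ▸ hI) (by
      intro l hl hcl
      obtain ⟨c, hc⟩ := hs (l.map Item.pt) (hp ▸ hl.map _) (by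
        simp only [List.mem_map]
        rintro _ ⟨a, ha, rfl⟩ _ ⟨b, hb, rfl⟩
        exact hcl a ha b hb)
      exact ⟨c, List.pairwise_map.1 hc⟩)
  rw [hpts] at hv h1 h2
  have hlen : items.length = I.length := by rw [← hp, List.length_map]
  have hsz : I.length ≤ t.size I.toFinset := by
    rw [← List.toFinset_card_of_nodup hI, Finset.card_eq_sum_ones]
    exact Finset.sum_le_sum fun s _ => by omega
  refine ⟨t, hv, ?_⟩
  simp only [List.length_nil] at h1
  simp only [runtime, paretoFrontT, steps_bind, ← hitems, val_lengthT, steps_lengthT,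
    steps_reverseT, steps_pure]
  omega

/-! ### Addresses in a pivot tree -/

namespace PivotTree

variable {γ : Type*} {cl : ℝ × ℝ → γ} {t : PivotTree} {S : Finset (ℝ × ℝ)}

theorem addr_of_up {q s : ℝ × ℝ} (a b : PivotTree) (h : q.2 < s.2) :
    (node q a b).addr s = false :: a.addr s := by simp [addr, h]

theorem addr_of_right {q s : ℝ × ℝ} (a b : PivotTree) (h : ¬ q.2 < s.2) (h' : q.1 < s.1) :
    (node q a b).addr s = true :: b.addr s := by simp [addr, h, h']

theorem addr_of_not {q s : ℝ × ℝ} (a b : PivotTree) (h : ¬ q.2 < s.2) (h' : ¬ q.1 < s.1) :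
    (node q a b).addr s = [] := by simp [addr, h, h']

theorem false_cons_prefix_addr {q s : ℝ × ℝ} {a b : PivotTree} {w : List Bool} :
    (false :: w) <+: (node q a b).addr s ↔ q.2 < s.2 ∧ w <+: a.addr s := by
  by_cases h : q.2 < s.2
  · simp [addr, h, List.cons_prefix_cons]
  · by_cases h' : q.1 < s.1 <;> simp [addr, h, h', List.cons_prefix_cons]

theorem true_cons_prefix_addr {q s : ℝ × ℝ} {a b : PivotTree} {w : List Bool} :
    (true :: w) <+: (node q a b).addr s ↔ ¬ q.2 < s.2 ∧ q.1 < s.1 ∧ w <+: b.addr s := by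
  by_cases h : q.2 < s.2
  · simp [addr, h, List.cons_prefix_cons]
  · by_cases h' : q.1 < s.1 <;> simp [addr, h, h', List.cons_prefix_cons]

/-- The subproblem at depth `d` has at most the `2 ^ d`-th part of the points. -/
theorem Valid.card_prefix_le (hv : t.Valid cl S) (w : List Bool) :
    2 ^ w.length * (S.filter fun s => w <+: t.addr s).card ≤ S.card := by
  induction t generalizing S w with
  | leaf =>
    cases w with
    | nil => simp
    | cons c w => simp [addr]
  | node q a b iha ihb =>
    obtain ⟨-, hd, h1, h2, va, vb⟩ := hv
    match w with
    | [] => simp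
    | false :: w =>
      have := iha va w
      simp only [false_cons_prefix_addr, Finset.filter_and, List.length_cons, pow_succ]
      rw [← Finset.filter_and, ← Finset.filter_filter]
      linarith
    | true :: w =>
      have := ihb vb w
      have hsub : (S.filter fun s => ¬ q.2 < s.2 ∧ q.1 < s.1 ∧ w <+: b.addr s)
          ⊆ (S.filter fun s => q.1 < s.1).filter fun s => w <+: b.addr s := by
        intro s
        simp only [Finset.mem_filter]
        tauto
      have := Finset.card_le_card hsub
      simp only [true_cons_prefix_addr, List.length_cons, pow_succ]
      nlinarith [pow_pos (show 0 < 2 by norm_num) w.length]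

/-- A dominating point is in every subproblem of the points that it dominates. -/
theorem Valid.addr_prefix_of_dominates (hv : t.Valid cl S) {p s : ℝ × ℝ} (hp : p ∈ S)
    (hs : s ∈ S) (h : Dominates p s) : t.addr s <+: t.addr p := by
  induction t generalizing S with
  | leaf => simp [addr]
  | node q a b iha ihb =>
    obtain ⟨-, hd, h1, h2, va, vb⟩ := hv
    by_cases hup : q.2 < s.2
    · have hp' := lt_of_lt_of_le hup h.2.2
      rw [addr_of_up a b hup, addr_of_up a b hp', List.cons_prefix_cons]
      exact ⟨rfl, iha va (Finset.mem_filter.2 ⟨hp, hp'⟩) (Finset.mem_filter.2 ⟨hs, hup⟩)⟩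
    · by_cases hr : q.1 < s.1
      · have hp' := lt_of_lt_of_le hr h.2.1
        rw [addr_of_right a b hup hr, addr_of_right a b (fun h => hd p hp h hp') hp',
          List.cons_prefix_cons]
        exact ⟨rfl, ihb vb (Finset.mem_filter.2 ⟨hp, hp'⟩) (Finset.mem_filter.2 ⟨hs, hr⟩)⟩
      · rw [addr_of_not a b hup hr]
        exact List.nil_prefix

/-- A subproblem that is split meets a second class. -/
theorem Valid.exists_ne_class (hv : t.Valid cl S) {s : ℝ × ℝ} (hs : s ∈ S) {w : List Bool}
    {c : Bool} (h : (w ++ [c]) <+: t.addr s) : ∃ u ∈ S, cl u ≠ cl s ∧ w <+: t.addr u := by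
  induction t generalizing S w with
  | leaf => simp [addr] at h
  | node q a b iha ihb =>
    obtain ⟨⟨u, hu, u', hu', hne⟩, hd, h1, h2, va, vb⟩ := hv
    match w with
    | [] =>
      by_cases hc : cl u = cl s
      · exact ⟨u', hu', fun h => hne (hc.trans h.symm), List.nil_prefix⟩
      · exact ⟨u, hu, hc, List.nil_prefix⟩
    | false :: w =>
      rw [List.cons_append, false_cons_prefix_addr] at h
      obtain ⟨u, hu, hne, hw⟩ := iha va (Finset.mem_filter.2 ⟨hs, h.1⟩) h.2
      rw [Finset.mem_filter] at hu
      exact ⟨u, hu.1, hne, false_cons_prefix_addr.2 ⟨hu.2, hw⟩⟩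
    | true :: w =>
      rw [List.cons_append, true_cons_prefix_addr] at h
      obtain ⟨u, hu, hne, hw⟩ := ihb vb (Finset.mem_filter.2 ⟨hs, h.2.1⟩) h.2.2
      rw [Finset.mem_filter] at hu
      exact ⟨u, hu.1, hne, true_cons_prefix_addr.2 ⟨fun h => hd u hu.1 h hu.2, hu.2, hw⟩⟩

/-- Two subproblems of the same depth are separated in both coordinates. -/
theorem Valid.separated (hv : t.Valid cl S) {w w' : List Bool} (hl : w.length = w'.length)
    (hne : w ≠ w') :
    (∀ s ∈ S, ∀ u ∈ S, w <+: t.addr s → w' <+: t.addr u → s.1 < u.1 ∧ u.2 < s.2) ∨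
      (∀ s ∈ S, ∀ u ∈ S, w <+: t.addr s → w' <+: t.addr u → u.1 < s.1 ∧ s.2 < u.2) := by
  induction t generalizing S w w' with
  | leaf =>
    cases w with
    | nil => exact absurd (List.length_eq_zero_iff.1 hl.symm).symm hne
    | cons c w => simp [addr]
  | node q a b iha ihb =>
    obtain ⟨-, hd, h1, h2, va, vb⟩ := hv
    match w, w' with
    | [], w' => exact absurd (List.length_eq_zero_iff.1 hl.symm).symm hne
    | _ :: _, [] => simp at hl
    -- The points above the pivot are not to its right, so the upper subproblem lies to the left of
    -- the right one, and above it.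
    | false :: w, true :: w' =>
      left
      intro s hs u hu h h'
      rw [false_cons_prefix_addr] at h
      rw [true_cons_prefix_addr] at h'
      have := hd s hs h.1
      exact ⟨by linarith [h'.2.1], by linarith [h.1, h'.1]⟩
    | true :: w, false :: w' =>
      right
      intro s hs u hu h h'
      rw [false_cons_prefix_addr] at h'
      rw [true_cons_prefix_addr] at h
      have := hd u hu h'.1
      exact ⟨by linarith [h.2.1], by linarith [h.1, h'.1]⟩
    | false :: w, false :: w' =>
      refine (iha va (by simpa using hl) (by simpa using hne)).imp ?_ ?_ <;>
      · intro ih s hs u hu h h'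
        rw [false_cons_prefix_addr] at h h'
        exact ih s (Finset.mem_filter.2 ⟨hs, h.1⟩) u (Finset.mem_filter.2 ⟨hu, h'.1⟩) h.2 h'.2
    | true :: w, true :: w' =>
      refine (ihb vb (by simpa using hl) (by simpa using hne)).imp ?_ ?_ <;>
      · intro ih s hs u hu h h'
        rw [true_cons_prefix_addr] at h h'
        exact ih s (Finset.mem_filter.2 ⟨hs, h.2.1⟩) u (Finset.mem_filter.2 ⟨hu, h'.2.1⟩)
          h.2.2 h'.2.2

end PivotTree

/-- Two separated pairs of reals cannot both leave an interval on the same side. -/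
theorem not_both_leave {J : Set ℝ} (hJ : J.OrdConnected) {s u s' u' : ℝ} (hs : s ∈ J)
    (hs' : s' ∈ J) (hu : u ∉ J) (hu' : u' ∉ J)
    (h : (u < s ∧ u' < s') ∨ (s < u ∧ s' < u'))
    (hsep : (s < u' ∧ u < s') ∨ (u' < s ∧ s' < u)) : False := by
  rcases h with ⟨h1, h2⟩ | ⟨h1, h2⟩ <;> rcases hsep with ⟨h3, h4⟩ | ⟨h3, h4⟩
  · exact hu' (hJ.out hs hs' ⟨h3.le, h2.le⟩)
  · exact hu (hJ.out hs' hs ⟨h4.le, h1.le⟩)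
  · exact hu (hJ.out hs hs' ⟨h1.le, h4.le⟩)
  · exact hu' (hJ.out hs' hs ⟨h2.le, h3.le⟩)

/-- The `x`-coordinate for `true` and the `y`-coordinate for `false`. -/
def coord (c : Bool) (s : ℝ × ℝ) : ℝ := if c then s.1 else s.2

/-- The subproblem with address `w` has a point of the rectangle `J true ×ˢ J false` and a point
that is outside of it in direction `c` and on the side `e`. -/
def PivotTree.Leaves (t : PivotTree) (S : Finset (ℝ × ℝ)) (J : Bool → Set ℝ) (w : List Bool)
    (c e : Bool) : Prop :=
  ∃ s ∈ S, ∃ u ∈ S, w <+: t.addr s ∧ w <+: t.addr u ∧ coord c s ∈ J c ∧ coord c u ∉ J c ∧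
    if e then coord c u < coord c s else coord c s < coord c u

/-! ### Few addresses in a rectangle, and geometric sums over addresses -/

namespace PivotTree

variable {γ : Type*} {cl : ℝ × ℝ → γ} {t : PivotTree} {S : Finset (ℝ × ℝ)}

/-- Distinct subproblems of equal depth occupy separated ranges of each coordinate. If two of them
left `J c` on the same side, the outer point of one would lie between two points of `J c`, against
convexity. -/
theorem Valid.eq_of_leaves (hv : t.Valid cl S) {J : Bool → Set ℝ} (hJ : ∀ c, (J c).OrdConnected)
    {w w' : List Bool} (hl : w.length = w'.length) {c e : Bool} (h : t.Leaves S J w c e)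
    (h' : t.Leaves S J w' c e) : w = w' := by
  by_contra hne
  obtain ⟨s, hs, u, hu, ws, wu, js, ju, hsu⟩ := h
  obtain ⟨s', hs', u', hu', ws', wu', js', ju', hsu'⟩ := h'
  refine not_both_leave (hJ c) js js' ju ju' ?_ ?_
  · cases e
    · exact Or.inr ⟨hsu, hsu'⟩
    · exact Or.inl ⟨hsu, hsu'⟩
  · rcases hv.separated hl hne with h | h <;> cases c <;> simp only [coord] <;>
      have h1 := h s hs u' hu' ws wu' <;> have h2 := h u hu s' hs' wu ws' <;> simp <;> tauto

theorem exists_leaves {J : Bool → Set ℝ} {s u : ℝ × ℝ} (hs : s ∈ S) (hu : u ∈ S) {w : List Bool}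
    (ws : w <+: t.addr s) (wu : w <+: t.addr u) (js : ∀ c, coord c s ∈ J c)
    (ju : ¬ ∀ c, coord c u ∈ J c) : ∃ ce : Bool × Bool, t.Leaves S J w ce.1 ce.2 := by
  push Not at ju
  obtain ⟨c, hc⟩ := ju
  rcases lt_trichotomy (coord c u) (coord c s) with h | h | h
  · exact ⟨(c, true), s, hs, u, hu, ws, wu, js c, hc, by simpa using h⟩
  · exact absurd (h ▸ js c) hc
  · exact ⟨(c, false), s, hs, u, hu, ws, wu, js c, hc, by simpa using h⟩

open Classical in
/-- The points of a class that is cut out by a rectangle have at most eight addresses of each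
length. -/
theorem Valid.card_addr_le (hv : t.Valid cl S) {r : Set (ℝ × ℝ)} (hr : IsRectangle r) (k : γ)
    (hk : ∀ s ∈ S, cl s = k ↔ s ∈ r) (d : ℕ) :
    (((S.filter fun s => cl s = k).image t.addr).filter fun w => w.length = d).card ≤ 8 := by
  obtain ⟨J₁, J₂, h1, h2, rfl⟩ := hr
  set J : Bool → Set ℝ := fun c => if c then J₁ else J₂ with hJdef
  have hJ : ∀ c, (J c).OrdConnected := by
    intro c; cases c <;> simp [hJdef, h1, h2]
  have hmem : ∀ s, s ∈ J₁ ×ˢ J₂ ↔ ∀ c, coord c s ∈ J c := by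
    intro s; simp [hJdef, coord, and_comm]
  -- The argument below looks at the parent subproblem, which the empty address does not have.
  rcases Nat.eq_zero_or_pos d with rfl | hd
  · refine (Finset.card_le_card (t := {[]}) ?_).trans (by simp)
    intro w hw
    simpa using (Finset.mem_filter.1 hw).2
  -- The parent was split, so it meets another class and hence has a point outside the rectangle.
  have key : ∀ w ∈ ((S.filter fun s => cl s = k).image t.addr).filter fun w => w.length = d,
      ∃ ce : Bool × Bool, t.Leaves S J w.dropLast ce.1 ce.2 := by
    intro w hw
    obtain ⟨hw, hwd⟩ := Finset.mem_filter.1 hw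
    obtain ⟨s, hs, rfl⟩ := Finset.mem_image.1 hw
    obtain ⟨hs, hsk⟩ := Finset.mem_filter.1 hs
    have hne : t.addr s ≠ [] := by
      rw [← List.length_pos_iff]; omega
    have happ := List.dropLast_append_getLast hne
    obtain ⟨u, hu, hcl, hwu⟩ := hv.exists_ne_class hs (w := (t.addr s).dropLast)
      (c := (t.addr s).getLast hne) (by rw [happ])
    refine exists_leaves hs hu (List.dropLast_prefix _) hwu ((hmem s).1 ((hk s hs).1 hsk)) ?_
    rw [← hmem, ← hk u hu]
    exact fun h => hcl (h.trans hsk.symm)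
  choose! f hf using key
  have hcard : (Finset.univ : Finset (Bool × Bool × Bool)).card = 8 := by decide
  rw [← hcard]
  -- The coordinate and the side of leaving determine the parent, and the last entry determines the
  -- child: `4 * 2 = 8`.
  refine Finset.card_le_card_of_injOn (fun w : List Bool => (w.getLastD false, f w))
    (fun _ _ => Finset.mem_univ _) ?_
  intro w hw w' hw' h
  have hw1 := (Finset.mem_filter.1 hw).2
  have hw1' := (Finset.mem_filter.1 hw').2
  have hf1 := hf w hw
  have hf2 := hf w' hw'
  simp only [Prod.mk.injEq] at h
  rw [← h.2] at hf2
  have heq := hv.eq_of_leaves hJ (by simp [hw1, hw1']) hf1 hf2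
  have hne : w ≠ [] := by rw [← List.length_pos_iff]; omega
  have hne' : w' ≠ [] := by rw [← List.length_pos_iff]; omega
  rw [← List.dropLast_append_getLast hne, ← List.dropLast_append_getLast hne', heq]
  have hlast := h.1
  rw [List.getLastD_eq_getLast?, List.getLastD_eq_getLast?, List.getLast?_eq_some_getLast hne,
    List.getLast?_eq_some_getLast hne'] at hlast
  simpa using hlast

open Classical in
/-- The geometric sum over the addresses of a class that is cut out by a rectangle. -/
theorem Valid.sum_addr_le (hv : t.Valid cl S) {r : Set (ℝ × ℝ)} (hr : IsRectangle r) (k : γ)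
    (hk : ∀ s ∈ S, cl s = k ↔ s ∈ r) :
    ∑ w ∈ (S.filter fun s => cl s = k).image t.addr, (4 / 5 : ℝ) ^ w.length ≤ 40 := by
  set W := (S.filter fun s => cl s = k).image t.addr with hW
  rw [← Finset.sum_fiberwise_of_maps_to (t := W.image List.length)
    (fun w hw => Finset.mem_image_of_mem _ hw)]
  calc ∑ d ∈ W.image List.length, ∑ w ∈ W with w.length = d, (4 / 5 : ℝ) ^ w.length
      ≤ ∑ d ∈ W.image List.length, 8 * (4 / 5 : ℝ) ^ d := by
        refine Finset.sum_le_sum fun d _ => ?_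
        rw [Finset.sum_congr rfl fun w hw => by rw [(Finset.mem_filter.1 hw).2], Finset.sum_const,
          nsmul_eq_mul]
        have := hv.card_addr_le hr k hk d
        gcongr
        exact_mod_cast this
    _ = 8 * ∑ d ∈ W.image List.length, (4 / 5 : ℝ) ^ d := by rw [Finset.mul_sum]
    _ ≤ 8 * ∑' d : ℕ, (4 / 5 : ℝ) ^ d := by
        gcongr
        exact (summable_geometric_of_lt_one (by norm_num) (by norm_num)).sum_le_tsum _
          fun _ _ => by positivity
    _ = 40 := by rw [tsum_geometric_of_lt_one (by norm_num) (by norm_num)]; norm_num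

/-- The geometric sum over the points whose last subproblem contains a given point. -/
theorem Valid.sum_pow_le (hv : t.Valid cl S) (v : List Bool) :
    ∑ s ∈ S with t.addr s <+: v, (3 / 2 : ℝ) ^ (t.addr s).length ≤ 4 * S.card := by
  set T := S.filter fun s => t.addr s <+: v with hT
  rw [← Finset.sum_fiberwise_of_maps_to (t := T.image fun s => (t.addr s).length)
    (fun w hw => Finset.mem_image_of_mem _ hw)]
  calc ∑ d ∈ T.image (fun s => (t.addr s).length),
        ∑ s ∈ T with (t.addr s).length = d, (3 / 2 : ℝ) ^ (t.addr s).length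
      ≤ ∑ d ∈ T.image (fun s => (t.addr s).length), (S.card : ℝ) * (3 / 4 : ℝ) ^ d := by
        refine Finset.sum_le_sum fun d hd => ?_
        rw [Finset.sum_congr rfl fun w hw => by rw [(Finset.mem_filter.1 hw).2], Finset.sum_const,
          nsmul_eq_mul]
        obtain ⟨s, hs, rfl⟩ := Finset.mem_image.1 hd
        have hsv := (Finset.mem_filter.1 hs).2
        have h1 := hv.card_prefix_le (t.addr s)
        -- Prefixes of `v` of equal length coincide, so these points all lie in the single
        -- subproblem with address `t.addr s`.
        have h2 : (T.filter fun u => (t.addr u).length = (t.addr s).length).card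
            ≤ (S.filter fun u => t.addr s <+: t.addr u).card := by
          refine Finset.card_le_card fun u hu => ?_
          simp only [hT, Finset.mem_filter] at hu ⊢
          exact ⟨hu.1.1, List.prefix_of_prefix_length_le hsv hu.1.2 hu.2.ge⟩
        have h3 : (2 : ℝ) ^ (t.addr s).length *
            (T.filter fun u => (t.addr u).length = (t.addr s).length).card ≤ S.card := by
          exact_mod_cast (Nat.mul_le_mul_left _ h2).trans h1
        have h4 : (3 / 2 : ℝ) ^ (t.addr s).length
            = 2 ^ (t.addr s).length * (3 / 4 : ℝ) ^ (t.addr s).length := by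
          rw [← mul_pow]; norm_num
        rw [h4, ← mul_assoc, mul_comm _ ((2 : ℝ) ^ _)]
        gcongr
    _ = S.card * ∑ d ∈ T.image (fun s => (t.addr s).length), (3 / 4 : ℝ) ^ d := by
        rw [Finset.mul_sum]
    _ ≤ S.card * ∑' d : ℕ, (3 / 4 : ℝ) ^ d := by
        gcongr
        exact (summable_geometric_of_lt_one (by norm_num) (by norm_num)).sum_le_tsum _
          fun _ _ => by positivity
    _ = 4 * S.card := by rw [tsum_geometric_of_lt_one (by norm_num) (by norm_num)]; ring

end PivotTree

/-! ### Counting lemmas -/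

open scoped Nat

/-- A single term of the multinomial theorem. -/
theorem factorial_mul_prod_le {α κ : Type*} [DecidableEq κ] (A : Finset α) (key : α → κ)
    (x : κ → ℝ) (hx : ∀ k, 0 ≤ x k) :
    (A.card ! : ℝ) * ∏ s ∈ A, x (key s) ≤ (∑ k ∈ A.image key, x k) ^ A.card *
      ∏ k ∈ A.image key, ((A.filter fun s => key s = k).card ! : ℝ) := by
  set c : κ → ℕ := fun k => (A.filter fun s => key s = k).card with hc
  have hsum : ∑ k ∈ A.image key, c k = A.card :=
    (Finset.card_eq_sum_card_image key A).symm
  have hmem : c ∈ Finset.piAntidiag (A.image key) A.card := by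
    rw [Finset.mem_piAntidiag]
    refine ⟨hsum, fun k hk => ?_⟩
    obtain ⟨s, hs⟩ := Finset.card_pos.1 (Nat.pos_of_ne_zero hk)
    rw [Finset.mem_filter] at hs
    exact Finset.mem_image.2 ⟨s, hs⟩
  have hprod : ∏ s ∈ A, x (key s) = ∏ k ∈ A.image key, x k ^ c k := Finset.prod_comp x key
  have hspec : ((∏ k ∈ A.image key, (c k)! : ℕ) : ℝ) * Nat.multinomial (A.image key) c = A.card ! := by
    rw [← hsum]
    exact_mod_cast Nat.multinomial_spec (A.image key) c
  have hterm : (Nat.multinomial (A.image key) c : ℝ) * ∏ k ∈ A.image key, x k ^ c k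
      ≤ (∑ k ∈ A.image key, x k) ^ A.card := by
    rw [Finset.sum_pow_eq_sum_piAntidiag]
    exact Finset.single_le_sum (f := fun k => (Nat.multinomial (A.image key) k : ℝ) *
      ∏ i ∈ A.image key, x i ^ k i) (fun k _ => mul_nonneg (Nat.cast_nonneg _)
        (Finset.prod_nonneg fun i _ => pow_nonneg (hx i) _)) hmem
  rw [hprod, ← hspec]
  push_cast
  rw [mul_assoc, mul_comm]
  gcongr

/-- The inequality of arithmetic and geometric means. -/
theorem prod_le_pow_of_sum_le {α : Type*} (A : Finset α) (hA : A.Nonempty) (y : α → ℝ)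
    (hy : ∀ s ∈ A, 0 ≤ y s) {M : ℝ} (hM : ∑ s ∈ A, y s ≤ A.card * M) :
    ∏ s ∈ A, y s ≤ M ^ A.card := by
  have hn : (0 : ℝ) < A.card := by exact_mod_cast hA.card_pos
  have h := Real.geom_mean_le_arith_mean A (fun _ => 1) y (fun _ _ => zero_le_one)
    (by simpa using hn) hy
  simp only [Real.rpow_one, one_mul, Finset.sum_const, nsmul_eq_mul, mul_one] at h
  have h0 : 0 ≤ ∏ s ∈ A, y s := Finset.prod_nonneg hy
  calc ∏ s ∈ A, y s = ((∏ s ∈ A, y s) ^ (A.card : ℝ)⁻¹) ^ A.card :=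
        (Real.rpow_inv_natCast_pow h0 hA.card_pos.ne').symm
    _ ≤ M ^ A.card := by
        gcongr
        exact h.trans ((div_le_iff₀' hn).2 hM)

/-- The functions `α → ℕ` of total weight `n`. -/
def weights (α : Type*) [Fintype α] [DecidableEq α] (n : ℕ) : Finset (α → ℕ) :=
  (Fintype.piFinset fun _ => Finset.range (n + 1)).filter fun a => ∑ p, a p = n

/-- Evaluate the generating function at `1 / 2`: each weight function of total `n` contributes `(1 /
2) ^ n`, and the full product of truncated geometric series is at most `2 ^ Fintype.card α`. -/
theorem card_weights_le (α : Type*) [Fintype α] [DecidableEq α] (n : ℕ) :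
    ((weights α n).card : ℝ) ≤ 2 ^ n * 2 ^ Fintype.card α := by
  have h1 : ∑ a ∈ weights α n, ∏ p, (1 / 2 : ℝ) ^ a p = (weights α n).card * (1 / 2) ^ n := by
    rw [← nsmul_eq_mul, ← Finset.sum_const]
    refine Finset.sum_congr rfl fun a ha => ?_
    rw [Finset.prod_pow_eq_pow_sum, (Finset.mem_filter.1 ha).2]
  have h2 : ∑ a ∈ weights α n, ∏ p, (1 / 2 : ℝ) ^ a p ≤ 2 ^ Fintype.card α := by
    calc ∑ a ∈ weights α n, ∏ p, (1 / 2 : ℝ) ^ a p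
        ≤ ∑ a ∈ Fintype.piFinset fun _ : α => Finset.range (n + 1), ∏ p, (1 / 2 : ℝ) ^ a p :=
          Finset.sum_le_sum_of_subset_of_nonneg (Finset.filter_subset _ _) fun _ _ _ => by positivity
      _ = ∏ _p : α, ∑ i ∈ Finset.range (n + 1), (1 / 2 : ℝ) ^ i := by rw [Finset.prod_univ_sum]
      _ ≤ ∏ _p : α, (2 : ℝ) := by
          refine Finset.prod_le_prod (fun _ _ => by positivity) fun _ _ => ?_
          exact (summable_geometric_two.sum_le_tsum _ fun _ _ => by positivity).trans
            tsum_geometric_two.le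
      _ = 2 ^ Fintype.card α := by simp
  rw [h1, one_div, inv_pow, ← div_eq_mul_inv, div_le_iff₀ (by positivity)] at h2
  linarith

/-- The permutations that preserve `key`. -/
abbrev KeyPerm {α κ : Type*} (key : α → κ) : Type _ := {σ : Equiv.Perm α // key ∘ σ = key}

/-- Two labellings that are strictly monotone on each class of `key`, and that agree after
permutations preserving `key`, are equal. -/
theorem labelling_eq {α β κ : Type*} [Finite α] (key : α → κ) (ρ : α → ℕ)
    (hρ : Function.Injective ρ) (lt : β → β → Prop) (hlt : ∀ b c, lt b c → ¬ lt c b)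
    (f g : α → β) (hf : ∀ s t, key s = key t → ρ s < ρ t → lt (f s) (f t))
    (hg : ∀ s t, key s = key t → ρ s < ρ t → lt (g s) (g t)) (σ τ : KeyPerm key)
    (h : f ∘ σ.1 = g ∘ τ.1) : f = g ∧ σ = τ := by
  have hkey : ∀ (σ : KeyPerm key) s, key (σ.1 s) = key s := fun σ s => congrFun σ.2 s
  set π : Equiv.Perm α := σ.1.symm.trans τ.1 with hπ
  have hfg : ∀ s, f s = g (π s) := fun s => by
    simpa [hπ] using congrFun h (σ.1.symm s)
  have hπk : ∀ s, key (π s) = key s := fun s => by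
    have := hkey σ (σ.1.symm s)
    rw [Equiv.apply_symm_apply] at this
    exact (hkey τ _).trans this.symm
  have hid : ∀ s, π s = s := by
    by_contra hcon
    push Not at hcon
    -- Take the `ρ`-least `s` moved by `π`; both `π s` and `π.symm s` come later. Then `f` puts `f s
    -- = g (π s)` before `f (π.symm s) = g s`, while `g` puts `g s` before `g (π s)`.
    obtain ⟨s, hs, hmin⟩ := Set.exists_min_image {s | π s ≠ s} ρ (Set.toFinite _) hcon
    have hs : π s ≠ s := hs
    have hts : π (π.symm s) = s := π.apply_symm_apply s
    have hne : π.symm s ≠ s := fun h => hs (by rw [h] at hts; exact hts)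
    have hmt := hmin (π.symm s) (by
      change π (π.symm s) ≠ π.symm s
      rw [hts]; exact hne.symm)
    have hst : ρ s < ρ (π.symm s) := lt_of_le_of_ne hmt fun h => hne (hρ h).symm
    have hk : key s = key (π.symm s) := by rw [← hπk (π.symm s), hts]
    have h1 := hf s _ hk hst
    rw [hfg, hfg, hts] at h1
    have hms := hmin (π s) (fun h => hs (π.injective h))
    have hlt' : ρ s < ρ (π s) := lt_of_le_of_ne hms fun h => hs (hρ h).symm
    exact hlt _ _ h1 (hg _ _ (hπk s).symm hlt')
  refine ⟨funext fun s => by rw [hfg, hid], Subtype.ext (Equiv.ext fun s => ?_)⟩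
  have := hid (σ.1 s)
  simpa [hπ] using this.symm

/-- The main counting argument. Each `x : X` places the elements of `α` into slots, the slots of
`p` being numbered from `0`, monotonically on each class of `key`. -/
theorem card_mul_le_sum_weights {α κ X : Type*} [Fintype α] [DecidableEq α] [DecidableEq κ]
    [Fintype X] (key : α → κ) (ρ : α → ℕ)
    (hρ : Function.Injective ρ) (rel : α → α → Prop)
    [∀ s, DecidablePred (rel s)] (tgt : X → α → α) (rank : X → α → ℕ)
    (hrank : ∀ x s, rank x s < (Finset.univ.filter fun t => tgt x t = tgt x s).card)
    (hmono : ∀ x s t, key s = key t → ρ s < ρ t →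
      ρ (tgt x s) < ρ (tgt x t) ∨ (tgt x s = tgt x t ∧ rank x s < rank x t))
    (hinj : ∀ x y, tgt x = tgt y → rank x = rank y → x = y) (hrel : ∀ x s, rel s (tgt x s))
    (hcongr : ∀ s t p, key s = key t → rel s p → rel t p) :
    Fintype.card X * ∏ k ∈ Finset.univ.image key, (Finset.univ.filter fun s => key s = k).card ! ≤
      ∑ a ∈ weights α (Fintype.card α), ∏ s, ∑ p with rel s p, a p := by
  set load : X → α → ℕ := fun x p => (Finset.univ.filter fun t => tgt x t = p).card with hload
  have hmaps : ∀ x ∈ (Finset.univ : Finset X), load x ∈ weights α (Fintype.card α) := by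
    intro x _
    rw [weights, Finset.mem_filter, Fintype.mem_piFinset]
    refine ⟨fun p => Finset.mem_range.2 (Nat.lt_succ_of_le (Finset.card_le_univ _)), ?_⟩
    exact (Finset.card_eq_sum_card_fiberwise fun _ _ => Finset.mem_univ _).symm
  have hperm : Fintype.card (KeyPerm key)
      = ∏ k ∈ Finset.univ.image key, (Finset.univ.filter fun s => key s = k).card ! := by
    rw [DomMulAct.stabilizer_card' key]
    exact Finset.prod_congr rfl fun k _ => by rw [Fintype.card_subtype]
  -- Group `X` by loads. For fixed loads `a`, the map `(x, σ) ↦ pos x ∘ σ` is injective by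
  -- `labelling_eq`, and it sends `s` to a slot `(p, i)` with `rel s p` and `i < a p`.
  rw [← hperm, ← Finset.card_univ, Finset.card_eq_sum_card_fiberwise hmaps, Finset.sum_mul]
  refine Finset.sum_le_sum fun a _ => ?_
  rw [← Finset.card_univ, ← Finset.card_product]
  set slots : α → Finset (Σ _ : α, ℕ) :=
    fun s => (Finset.univ.filter (rel s)).sigma fun p => Finset.range (a p) with hslots
  have hcard : (Fintype.piFinset slots).card = ∏ s, ∑ p with rel s p, a p := by
    rw [Fintype.card_piFinset]
    exact Finset.prod_congr rfl fun s _ => by simp [hslots, Finset.card_sigma]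
  rw [← hcard]
  set pos : X → α → Σ _ : α, ℕ := fun x s => ⟨tgt x s, rank x s⟩ with hpos
  refine Finset.card_le_card_of_injOn (fun z : X × KeyPerm key => pos z.1 ∘ z.2.1) ?_ ?_
  · rintro ⟨x, σ⟩ hz
    have hx : load x = a := (Finset.mem_filter.1 (Finset.mem_product.1 hz).1).2
    rw [Finset.mem_coe, Fintype.mem_piFinset]
    intro s
    rw [Finset.mem_sigma, Finset.mem_filter, Finset.mem_range]
    refine ⟨⟨Finset.mem_univ _, hcongr _ _ _ (congrFun σ.2 s) (hrel x (σ.1 s))⟩, ?_⟩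
    rw [← hx]
    exact hrank x (σ.1 s)
  · rintro ⟨x, σ⟩ _ ⟨y, τ⟩ _ h
    obtain ⟨h1, h2⟩ := labelling_eq key ρ hρ
      (fun b c : Σ _ : α, ℕ => ρ b.1 < ρ c.1 ∨ (b.1 = c.1 ∧ b.2 < c.2)) (by
      rintro b c (h | ⟨h, h'⟩) (h2 | ⟨h2, h2'⟩)
      · omega
      · rw [h2] at h; omega
      · rw [h] at h2; omega
      · omega) (pos x) (pos y) (hmono x) (hmono y) σ τ h
    have h3 : ∀ s, pos x s = pos y s := congrFun h1
    have h4 : x = y := hinj x y (funext fun s => congrArg Sigma.fst (h3 s)) (funext fun s => by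
      have := h3 s
      simp only [hpos, Sigma.mk.injEq, heq_eq_eq] at this
      exact this.2)
    rw [h4, h2]

/-- Any numbering becomes increasing in `x` on each class of `key` after a permutation that
preserves `key`. -/
theorem exists_keyPerm_sorted {α κ : Type*} [Fintype α] [DecidableEq α] (key : α → κ) (x : α → ℝ)
    {n : ℕ} (f : α ≃ Fin n) :
    ∃ σ : KeyPerm key, ∀ p q, key p = key q → x p < x q → f (σ.1 p) < f (σ.1 q) := by
  have : Nonempty (KeyPerm key) := ⟨⟨1, rfl⟩⟩
  -- Rearrangement: a maximizer of this sum has no inversion inside a class, as swapping the two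
  -- elements would increase the sum.
  obtain ⟨σ, hσ⟩ := Finite.exists_max
    fun σ : KeyPerm key => ∑ r, ((f (σ.1 r) : ℕ) : ℝ) * x r
  refine ⟨σ, fun p q hk hx => ?_⟩
  by_contra hcon
  have hpq : p ≠ q := by rintro rfl; exact lt_irrefl _ hx
  have hlt : f (σ.1 q) < f (σ.1 p) := lt_of_le_of_ne (not_lt.1 hcon) fun h =>
    hpq (σ.1.injective (f.injective h)).symm
  have hsw : key ∘ (Equiv.swap p q : Equiv.Perm α) = key := by
    funext r
    simp only [Function.comp]
    rcases eq_or_ne r p with rfl | hrp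
    · rw [Equiv.swap_apply_left, hk]
    rcases eq_or_ne r q with rfl | hrq
    · rw [Equiv.swap_apply_right, hk]
    rw [Equiv.swap_apply_of_ne_of_ne hrp hrq]
  have h := hσ ⟨σ.1 * Equiv.swap p q, by
    rw [Equiv.Perm.coe_mul, ← Function.comp_assoc, σ.2, hsw]⟩
  simp only [Equiv.Perm.mul_apply] at h
  have hre : ∑ r, ((f (σ.1 (Equiv.swap p q r)) : ℕ) : ℝ) * x r
      = ∑ r, ((f (σ.1 r) : ℕ) : ℝ) * x (Equiv.swap p q r) := by
    rw [← Equiv.sum_comp (Equiv.swap p q)]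
    simp
  rw [hre, ← sub_nonpos, ← Finset.sum_sub_distrib, Fintype.sum_eq_add p q hpq] at h
  · rw [Equiv.swap_apply_left, Equiv.swap_apply_right] at h
    have : ((f (σ.1 q) : ℕ) : ℝ) < ((f (σ.1 p) : ℕ) : ℝ) := by exact_mod_cast hlt
    nlinarith
  · rintro r ⟨hrp, hrq⟩
    rw [Equiv.swap_apply_of_ne_of_ne hrp hrq, sub_self]

/-! ### Classes of points -/

open Classical in
/-- The region that contains `p`, or the singleton of `p` if there is none. -/
noncomputable def cell (R : Set (Set (ℝ × ℝ))) (p : ℝ × ℝ) : Set (ℝ × ℝ) :=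
  if h : ∃ r ∈ R, p ∈ r then h.choose else {p}

section cell

variable {R : Set (Set (ℝ × ℝ))}

theorem mem_cell (p : ℝ × ℝ) : p ∈ cell R p := by
  unfold cell
  split_ifs with h
  · exact h.choose_spec.2
  · rfl

theorem IsRegionSet.cell_eq (hR : IsRegionSet R) {r : Set (ℝ × ℝ)} (hr : r ∈ R) {p : ℝ × ℝ}
    (hp : p ∈ r) : cell R p = r := by
  have h : ∃ r ∈ R, p ∈ r := ⟨r, hr, hp⟩
  rw [cell, dif_pos h]
  by_contra hne
  exact Set.disjoint_left.1 (hR.disj h.choose_spec.1 hr hne) h.choose_spec.2 hp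

theorem cell_of_not {p : ℝ × ℝ} (h : ¬ ∃ r ∈ R, p ∈ r) : cell R p = {p} := by
  rw [cell, dif_neg h]

theorem IsRegionSet.isRectangle_cell (hR : IsRegionSet R) (p : ℝ × ℝ) :
    IsRectangle (cell R p) := by
  by_cases h : ∃ r ∈ R, p ∈ r
  · obtain ⟨r, hr, hp⟩ := h
    rw [hR.cell_eq hr hp]
    exact hR.rect r hr
  · rw [cell_of_not h]
    exact ⟨{p.1}, {p.2}, Set.ordConnected_singleton, Set.ordConnected_singleton, by simp⟩

theorem IsRegionSet.cell_eq_cell_iff (hR : IsRegionSet R) {p q : ℝ × ℝ} :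
    cell R q = cell R p ↔ q ∈ cell R p := by
  refine ⟨fun h => h ▸ mem_cell q, fun hq => ?_⟩
  by_cases h : ∃ r ∈ R, p ∈ r
  · obtain ⟨r, hr, hp⟩ := h
    rw [hR.cell_eq hr hp] at hq ⊢
    exact hR.cell_eq hr hq
  · rw [cell_of_not h] at hq
    rw [Set.mem_singleton_iff.1 hq]

theorem IsRegionSet.eq_or_exists_region (hR : IsRegionSet R) {p q : ℝ × ℝ}
    (h : cell R q = cell R p) : q = p ∨ ∃ r ∈ R, p ∈ r ∧ q ∈ r := by
  rw [hR.cell_eq_cell_iff] at h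
  by_cases hp : ∃ r ∈ R, p ∈ r
  · obtain ⟨r, hr, hp⟩ := hp
    rw [hR.cell_eq hr hp] at h
    exact Or.inr ⟨r, hr, hp, h⟩
  · rw [cell_of_not hp] at h
    exact Or.inl h

theorem IsRegionSet.exists_sorted (hR : IsRegionSet R) {P : Finset (ℝ × ℝ)} {I : List (ℝ × ℝ)}
    (hI : I ∈ inputs P R) (l : List (ℝ × ℝ)) (hl : l.Sublist I)
    (hc : ∀ p ∈ l, ∀ q ∈ l, cell R p = cell R q) : ∃ c : Compass, l.Pairwise c.rel := by
  obtain ⟨hnd, -, hresp⟩ := hI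
  match l with
  | [] => exact ⟨.incX, List.Pairwise.nil⟩
  | p :: l =>
    by_cases hp : ∃ r ∈ R, p ∈ r
    · obtain ⟨r, hr, hp⟩ := hp
      have hmem : ∀ q ∈ p :: l, q ∈ r := fun q hq => by
        have := hR.cell_eq_cell_iff.1 (hc q hq p (by simp))
        rwa [hR.cell_eq hr hp] at this
      obtain ⟨c, hcc⟩ := hresp r hr
      exact ⟨c, (hcc.sublist hl).imp_of_mem fun ha hb h => h (hmem _ ha) (hmem _ hb)⟩
    · match l with
      | [] => exact ⟨.incX, List.pairwise_singleton _ _⟩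
      | q :: l =>
        have h := hR.cell_eq_cell_iff.1 (hc q (by simp) p (by simp))
        rw [cell_of_not hp, Set.mem_singleton_iff] at h
        have := hnd.sublist hl
        simp [h] at this

end cell

/-! ### The size of the universe -/

theorem finite_inputs (P : Finset (ℝ × ℝ)) (R : Set (Set (ℝ × ℝ))) : (inputs P R).Finite := by
  refine (P.toList.permutations.toFinset.finite_toSet).subset fun I hI => ?_
  rw [Finset.mem_coe, List.mem_toFinset, List.mem_permutations]
  exact (List.perm_ext_iff_of_nodup hI.1 P.nodup_toList).2 fun p => by
    rw [hI.2.1 p, Finset.mem_toList]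

open Classical in
-- Any numbering of `P`, sorted by `x` inside the cells, is an input. The numbering is recovered
-- from that input and the cell-preserving permutation that was applied.
theorem factorial_le_inputs {P : Finset (ℝ × ℝ)} {R : Set (Set (ℝ × ℝ))}
    (hP : Set.InjOn Prod.fst (P : Set (ℝ × ℝ))) (hR : IsRegionSet R) :
    P.card ! ≤ (inputs P R).ncard * ∏ k ∈ Finset.univ.image fun s : P => cell R s,
      (Finset.univ.filter fun s : P => cell R s = k).card ! := by
  set key : P → Set (ℝ × ℝ) := fun s => cell R s with hkey
  set n := P.card with hn
  have e : P ≃ Fin n := Fintype.equivFinOfCardEq (by simp [hn])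
  have hperm : Fintype.card (KeyPerm key)
      = ∏ k ∈ Finset.univ.image key, (Finset.univ.filter fun s => key s = k).card ! := by
    rw [DomMulAct.stabilizer_card' key]
    exact Finset.prod_congr rfl fun k _ => by rw [Fintype.card_subtype]
  have : Finite (inputs P R) := finite_inputs P R
  rw [← hperm, ← Nat.card_coe_set_eq, ← Nat.card_eq_fintype_card, ← Nat.card_prod]
  have hfact : n ! = Nat.card (P ≃ Fin n) := by
    rw [Nat.card_eq_fintype_card, Fintype.card_equiv e, Fintype.card_coe]
  rw [hfact]
  choose σ hσ using fun f : P ≃ Fin n => exists_keyPerm_sorted key (fun s : P => s.1.1) f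
  set g : (P ≃ Fin n) → (P ≃ Fin n) := fun f => (σ f).1.trans f with hg
  have hin : ∀ f, List.ofFn (fun i => ((g f).symm i).1) ∈ inputs P R := by
    intro f
    refine ⟨?_, fun p => ?_, fun r hr => ⟨.incX, ?_⟩⟩
    · exact List.nodup_ofFn_ofInjective (Subtype.val_injective.comp (g f).symm.injective)
    · rw [List.mem_ofFn']
      constructor
      · rintro ⟨i, rfl⟩; exact Subtype.prop _
      · intro hp; exact ⟨g f ⟨p, hp⟩, by simp⟩
    · rw [List.pairwise_ofFn]
      intro i j hij hi hj
      change ((g f).symm i).1.1 < ((g f).symm j).1.1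
      have hk : key ((g f).symm i) = key ((g f).symm j) :=
        (hR.cell_eq hr hi).trans (hR.cell_eq hr hj).symm
      rcases lt_trichotomy (((g f).symm i).1.1) (((g f).symm j).1.1) with h | h | h
      · exact h
      · have := (g f).symm.injective (Subtype.ext (hP ((g f).symm i).2 ((g f).symm j).2 h))
        exact absurd this hij.ne
      · have h2 : g f ((g f).symm j) < g f ((g f).symm i) := hσ f _ _ hk.symm h
        rw [Equiv.apply_symm_apply, Equiv.apply_symm_apply] at h2
        exact absurd h2 (not_lt.2 hij.le)
  refine Nat.card_le_card_of_injective
    (fun f => ((⟨_, hin f⟩ : inputs P R), σ f)) fun f f' h => ?_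
  simp only [Prod.mk.injEq, Subtype.mk.injEq] at h
  have h1 := List.ofFn_injective h.1
  have h2 : (g f).symm = (g f').symm := Equiv.ext fun i => Subtype.ext (congrFun h1 i)
  have h3 : g f = g f' := by rw [← Equiv.symm_symm (g f), h2, Equiv.symm_symm]
  refine Equiv.ext fun s => ?_
  have h4 := congrArg (fun u : P ≃ Fin n => u ((σ f).1.symm s)) h3
  simpa [hg, h.2] using h4

/-! ### The number of ordered normalized downdrafts -/

section OND

variable {P : Finset (ℝ × ℝ)} {R : Set (Set (ℝ × ℝ))} {L : P → P → Prop}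

open Classical in
/-- The target of a point: its witness, or itself for a front point. -/
noncomputable def target (ψ : NonFront P → P) (s : P) : P :=
  if h : OnFront P s then s else ψ ⟨s, h⟩

open Classical in
/-- The rank of a point in its fiber, and `0` for a front point. -/
noncomputable def fiberRank (prec : NonFront P → NonFront P → Prop) (s : P) : ℕ :=
  if h : OnFront P s then 0 else (Finset.univ.filter fun t : NonFront P => prec t ⟨s, h⟩).card

theorem target_of_nonFront (ψ : NonFront P → P) (s : NonFront P) : target ψ s.1 = ψ s := by
  rw [target, dif_neg s.2]

open Classical in
theorem fiberRank_of_nonFront (prec : NonFront P → NonFront P → Prop) (s : NonFront P) :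
    fiberRank prec s.1 = (Finset.univ.filter fun t : NonFront P => prec t s).card := by
  rw [fiberRank, dif_neg s.2]

theorem IsFiberOrder.fiberRank_lt {ψ : NonFront P → P} {prec : NonFront P → NonFront P → Prop}
    (h : IsFiberOrder ψ prec) {s t : NonFront P} (hst : prec s t) :
    fiberRank prec s.1 < fiberRank prec t.1 := by
  classical
  rw [fiberRank_of_nonFront, fiberRank_of_nonFront]
  refine Finset.card_lt_card ⟨fun u hu => ?_, fun hsub => ?_⟩
  · rw [Finset.mem_filter] at hu ⊢
    exact ⟨hu.1, h.trans _ _ _ hu.2 hst⟩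
  · have := hsub (Finset.mem_filter.2 ⟨Finset.mem_univ s, hst⟩)
    exact h.irrefl s (Finset.mem_filter.1 this).2

theorem IsFiberOrder.prec_iff {ψ : NonFront P → P} {prec : NonFront P → NonFront P → Prop}
    (h : IsFiberOrder ψ prec) {s t : NonFront P} :
    prec s t ↔ ψ s = ψ t ∧ fiberRank prec s.1 < fiberRank prec t.1 := by
  refine ⟨fun hst => ⟨h.fiber _ _ hst, h.fiberRank_lt hst⟩, fun ⟨h1, h2⟩ => ?_⟩
  rcases h.total s t h1 (by rintro rfl; exact lt_irrefl _ h2) with h3 | h3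
  · exact h3
  · exact absurd (h.fiberRank_lt h3) h2.not_gt

open Classical in
-- The predecessors of a non-front point form a proper subset of its fiber, since the point itself
-- is missing; a front point has rank 0 in a fiber that contains it.
theorem IsFiberOrder.fiberRank_lt_card {ψ : NonFront P → P}
    {prec : NonFront P → NonFront P → Prop} (h : IsFiberOrder ψ prec) (s : P) :
    fiberRank prec s < (Finset.univ.filter fun t => target ψ t = target ψ s).card := by
  have hs : s ∈ Finset.univ.filter fun t => target ψ t = target ψ s := by simp
  by_cases hf : OnFront P s
  · rw [fiberRank, dif_pos hf]
    exact Finset.card_pos.2 ⟨s, hs⟩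
  · have := fiberRank_of_nonFront prec ⟨s, hf⟩
    simp only at this
    rw [this, ← Finset.card_map ⟨Subtype.val, Subtype.val_injective⟩]
    refine Finset.card_lt_card ((Finset.ssubset_iff_of_subset fun u hu => ?_).2 ⟨s, hs, ?_⟩)
    · obtain ⟨t, ht, rfl⟩ := Finset.mem_map.1 hu
      rw [Finset.mem_filter] at ht
      rw [Finset.mem_filter]
      refine ⟨Finset.mem_univ _, ?_⟩
      have h1 := h.fiber _ _ ht.2
      have h2 := target_of_nonFront ψ ⟨s, hf⟩
      simp only at h2
      rw [h2, ← h1]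
      exact target_of_nonFront ψ t
    · intro hu
      obtain ⟨t, ht, hts⟩ := Finset.mem_map.1 hu
      have : t = ⟨s, hf⟩ := Subtype.ext hts
      rw [Finset.mem_filter, this] at ht
      exact h.irrefl _ ht.2

/-- The class of a point: its region, its address, and whether it is on the front. -/
noncomputable def classKey (R : Set (Set (ℝ × ℝ))) (t : PivotTree) (s : P) :
    Set (ℝ × ℝ) × List Bool × Prop :=
  (cell R s, t.addr s, OnFront P s)

open Classical in
-- The slot of a point is its witness together with its rank in the fiber; inside a region, slots
-- increase along `L`. A front point takes slot 0 of itself, possibly shared with a non-front point.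
-- This is harmless: monotonicity is needed only within a class, and no class mixes the two kinds.
theorem ncard_OND_mul_le (hR : IsRegionSet R) (hL : IsStrictTotalOrder P L) {t : PivotTree}
    (ht : t.Valid (cell R) P) :
    (OND P R L).ncard * ∏ k ∈ Finset.univ.image (classKey (P := P) R t),
      (Finset.univ.filter fun s : P => classKey R t s = k).card ! ≤
    ∑ a ∈ weights P P.card, ∏ s : P, ∑ p with t.addr s.1 <+: t.addr p.1, a p := by
  set ρ : P → ℕ := fun p => (Finset.univ.filter fun q => L q p).card with hρ
  have hρlt : ∀ p q, L p q → ρ p < ρ q := by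
    intro p q hpq
    refine Finset.card_lt_card ⟨fun u hu => ?_, fun hsub => ?_⟩
    · rw [Finset.mem_filter] at hu ⊢
      exact ⟨hu.1, _root_.trans hu.2 hpq⟩
    · have := hsub (Finset.mem_filter.2 ⟨Finset.mem_univ p, hpq⟩)
      exact irrefl p (Finset.mem_filter.1 this).2
  have htri : ∀ p q, L p q ∨ p = q ∨ L q p := trichotomous_of L
  have hρinj : Function.Injective ρ := by
    intro p q h
    rcases htri p q with h1 | h1 | h1
    · exact absurd h (hρlt _ _ h1).ne
    · exact h1
    · exact absurd h (hρlt _ _ h1).ne'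
  have hρL : ∀ p q, ρ p < ρ q → L p q := by
    intro p q h
    rcases htri p q with h1 | rfl | h1
    · exact h1
    · exact absurd h (lt_irrefl _)
    · exact absurd h (hρlt _ _ h1).not_gt
  have hcard : (OND P R L).ncard = Fintype.card (OND P R L) := by
    rw [← Nat.card_coe_set_eq, Nat.card_eq_fintype_card]
  have hcP : P.card = Fintype.card P := (Fintype.card_coe P).symm
  rw [hcard, hcP]
  refine card_mul_le_sum_weights (classKey R t) ρ hρinj
    (fun s p => t.addr s.1 <+: t.addr p.1) (fun x : OND P R L => target x.1.1)
    (fun x => fiberRank x.1.2) ?_ ?_ ?_ ?_ ?_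
  · exact fun x s => x.2.2.1.fiberRank_lt_card s
  · rintro ⟨⟨ψ, prec⟩, ⟨hd, hmono⟩, hfo, hord⟩ s u hk hlt
    simp only [classKey, Prod.mk.injEq, eq_iff_iff] at hk
    obtain ⟨hk1, -, hk2⟩ := hk
    simp only at hmono hfo hord ⊢
    by_cases hs : OnFront P s
    · left
      simpa [target, hs, hk2.1 hs] using hlt
    · have hu : ¬ OnFront P u := fun h => hs (hk2.2 h)
      rcases hR.eq_or_exists_region hk1 with h | ⟨r, hr, hur, hsr⟩
      · rw [Subtype.ext h] at hlt; exact absurd hlt (lt_irrefl _)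
      · have hLsu := hρL _ _ hlt
        have e1 : target ψ s = ψ ⟨s, hs⟩ := target_of_nonFront ψ ⟨s, hs⟩
        have e2 : target ψ u = ψ ⟨u, hu⟩ := target_of_nonFront ψ ⟨u, hu⟩
        rw [e1, e2]
        rcases hmono r hr ⟨s, hs⟩ ⟨u, hu⟩ hsr hur hLsu with h | h
        · exact Or.inr ⟨h, hfo.fiberRank_lt ((hord r hr ⟨s, hs⟩ ⟨u, hu⟩ hsr hur h).1 hLsu)⟩
        · exact Or.inl (hρlt _ _ h)
  · rintro ⟨⟨ψ, prec⟩, hx⟩ ⟨⟨ψ', prec'⟩, hy⟩ h1 h2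
    simp only at h1 h2
    have h3 : ψ = ψ' := funext fun s => by
      rw [← target_of_nonFront ψ s, h1, target_of_nonFront]
    subst h3
    have h4 : prec = prec' := by
      funext s u
      have e1 := hx.2.1.prec_iff (s := s) (t := u)
      have e2 := hy.2.1.prec_iff (s := s) (t := u)
      simp only at e1 e2
      rw [eq_iff_iff, e1, e2, h2]
    subst h4
    rfl
  · rintro ⟨⟨ψ, prec⟩, ⟨hd, -⟩, -⟩ s
    by_cases hs : OnFront P s
    · simp [target, hs]
    · have e1 : target ψ s = ψ ⟨s, hs⟩ := target_of_nonFront ψ ⟨s, hs⟩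
      simp only [e1]
      exact ht.addr_prefix_of_dominates (ψ ⟨s, hs⟩).2 s.2 (hd ⟨s, hs⟩)
  · intro s u p hk h
    simp only [classKey, Prod.mk.injEq] at hk
    rwa [← hk.2.1]

end OND

/-! ### From the counts to a bound on the depth sum -/

section bounds

variable {P : Finset (ℝ × ℝ)} {R : Set (Set (ℝ × ℝ))} {t : PivotTree}

/-- The sum of the lengths of the addresses. -/
noncomputable def PivotTree.depthSum (t : PivotTree) (S : Finset (ℝ × ℝ)) : ℕ :=
  ∑ s ∈ S, (t.addr s).length

theorem PivotTree.size_eq (t : PivotTree) (S : Finset (ℝ × ℝ)) :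
    t.size S = t.depthSum S + S.card := by
  rw [size, depthSum, Finset.sum_add_distrib, Finset.card_eq_sum_ones]

theorem PivotTree.prod_pow_length (t : PivotTree) (P : Finset (ℝ × ℝ)) (x : ℝ) :
    ∏ s : P, x ^ (t.addr s.1).length = x ^ t.depthSum P := by
  rw [Finset.prod_pow_eq_pow_sum, PivotTree.depthSum, ← Finset.sum_coe_sort P]

open Classical in
-- The inequality of means is applied to the factors weighted by `(3 / 2) ^ length`. After
-- exchanging the sums, each of the `n` slots contributes the geometric sum over the addresses that
-- are prefixes of its owner's, at most `4 * n`.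
theorem prod_load_le (hP : P.Nonempty) (ht : t.Valid (cell R) P) {a : P → ℕ}
    (ha : a ∈ weights P P.card) :
    ((∏ s : P, ∑ p with t.addr s.1 <+: t.addr p.1, a p : ℕ) : ℝ) * (3 / 2) ^ t.depthSum P
      ≤ (4 * P.card) ^ P.card := by
  have hsum : ∑ p, a p = P.card := (Finset.mem_filter.1 ha).2
  have : Nonempty P := hP.to_subtype
  have key := prod_le_pow_of_sum_le (Finset.univ : Finset P) Finset.univ_nonempty
    (fun s => ((∑ p with t.addr s.1 <+: t.addr p.1, a p : ℕ) : ℝ) *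
      (3 / 2 : ℝ) ^ (t.addr s.1).length) (fun _ _ => by positivity) (M := 4 * P.card) ?_
  · rw [Finset.prod_mul_distrib, t.prod_pow_length P, ← Nat.cast_prod, Finset.card_univ,
      Fintype.card_coe] at key
    exact key
  · have hp : ∀ p : P, ∑ s : P, (if t.addr s.1 <+: t.addr p.1 then
        (3 / 2 : ℝ) ^ (t.addr s.1).length else 0) ≤ 4 * P.card := by
      intro p
      have h := ht.sum_pow_le (t.addr p.1)
      rw [Finset.sum_filter, ← Finset.sum_coe_sort P] at h
      exact h
    calc ∑ s : P, ((∑ p with t.addr s.1 <+: t.addr p.1, a p : ℕ) : ℝ) *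
          (3 / 2 : ℝ) ^ (t.addr s.1).length
        = ∑ s : P, ∑ p : P, (a p : ℝ) * (if t.addr s.1 <+: t.addr p.1 then
          (3 / 2 : ℝ) ^ (t.addr s.1).length else 0) := by
          refine Finset.sum_congr rfl fun s _ => ?_
          rw [Finset.sum_filter]
          push_cast
          rw [Finset.sum_mul]
          refine Finset.sum_congr rfl fun p _ => ?_
          split_ifs <;> simp
      _ = ∑ p : P, (a p : ℝ) * ∑ s : P, (if t.addr s.1 <+: t.addr p.1 then
          (3 / 2 : ℝ) ^ (t.addr s.1).length else 0) := by
          rw [Finset.sum_comm]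
          simp_rw [Finset.mul_sum]
      _ ≤ ∑ p : P, (a p : ℝ) * (4 * P.card) := by
          refine Finset.sum_le_sum fun p _ => ?_
          gcongr
          exact hp p
      _ = (Finset.univ : Finset P).card * (4 * P.card) := by
          rw [← Finset.sum_mul, ← Nat.cast_sum, hsum, Finset.card_univ, Fintype.card_coe]

open Classical in
-- Apply the multinomial theorem in each cell, a class with address `w` having weight `(4 / 5) ^
-- w.length`. The weights in a cell sum to at most `2 * 40`: the addresses give 40, and front
-- membership doubles it.
theorem prod_factorial_cell_le (hR : IsRegionSet R) (ht : t.Valid (cell R) P) :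
    ((∏ k ∈ Finset.univ.image fun s : P => cell R s,
      (Finset.univ.filter fun s : P => cell R s = k).card ! : ℕ) : ℝ) * (4 / 5) ^ t.depthSum P ≤
    80 ^ P.card * ((∏ k ∈ Finset.univ.image (classKey (P := P) R t),
      (Finset.univ.filter fun s : P => classKey R t s = k).card ! : ℕ) : ℝ) := by
  set K := Finset.univ.image fun s : P => cell R s with hK
  set A : Set (ℝ × ℝ) → Finset P := fun k => Finset.univ.filter fun s : P => cell R s = k with hA
  have hmaps : ∀ s ∈ (Finset.univ : Finset P), cell R s ∈ K :=
    fun s hs => Finset.mem_image_of_mem _ hs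
  have hsub : ∀ k ∈ K, ∑ g ∈ (A k).image (classKey R t), (4 / 5 : ℝ) ^ g.2.1.length ≤ 80 := by
    intro k hk
    obtain ⟨p, -, rfl⟩ := Finset.mem_image.1 hk
    have h40 := ht.sum_addr_le (hR.isRectangle_cell p.1) (cell R p.1)
      fun s _ => hR.cell_eq_cell_iff
    calc ∑ g ∈ (A (cell R p)).image (classKey R t), (4 / 5 : ℝ) ^ g.2.1.length
        ≤ ∑ g ∈ ({cell R p.1} : Finset (Set (ℝ × ℝ))) ×ˢ
            (((P.filter fun s => cell R s = cell R p.1).image t.addr) ×ˢ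
              (Finset.univ : Finset Prop)), (4 / 5 : ℝ) ^ g.2.1.length := by
          refine Finset.sum_le_sum_of_subset_of_nonneg (fun g hg => ?_) fun _ _ _ => by positivity
          obtain ⟨s, hs, rfl⟩ := Finset.mem_image.1 hg
          have hs' : cell R s.1 = cell R p.1 := (Finset.mem_filter.1 hs).2
          simp only [classKey, Finset.mem_product, Finset.mem_singleton, Finset.mem_univ, and_true]
          exact ⟨hs', Finset.mem_image.2 ⟨s, Finset.mem_filter.2 ⟨s.2, hs'⟩, rfl⟩⟩
      _ = 2 * ∑ w ∈ (P.filter fun s => cell R s = cell R p.1).image t.addr,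
            (4 / 5 : ℝ) ^ w.length := by
          rw [Finset.sum_product, Finset.sum_singleton, Finset.sum_product, Finset.mul_sum]
          refine Finset.sum_congr rfl fun w _ => ?_
          simp
      _ ≤ 2 * 40 := by
          gcongr
          refine (le_of_eq ?_).trans h40
          congr!
      _ = 80 := by norm_num
  have hone : ∀ k ∈ K, ((A k).card ! : ℝ) * ∏ s ∈ A k, (4 / 5 : ℝ) ^ (t.addr s.1).length
      ≤ 80 ^ (A k).card * ∏ g ∈ (A k).image (classKey R t),
        (((A k).filter fun s => classKey R t s = g).card ! : ℝ) := by
    intro k hk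
    refine (factorial_mul_prod_le (A k) (classKey R t) (fun g => (4 / 5 : ℝ) ^ g.2.1.length)
      fun _ => by positivity).trans ?_
    gcongr
    exact hsub k hk
  have h := Finset.prod_le_prod (fun _ _ => by positivity) hone
  rw [Finset.prod_mul_distrib, Finset.prod_mul_distrib, Finset.prod_fiberwise_of_maps_to hmaps,
    t.prod_pow_length P, Finset.prod_pow_eq_pow_sum,
    ← Finset.card_eq_sum_card_fiberwise hmaps, Finset.card_univ, Fintype.card_coe] at h
  push_cast
  refine h.trans (le_of_eq ?_)
  congr 1
  rw [← Finset.prod_fiberwise_of_maps_to (s := Finset.univ.image (classKey (P := P) R t)) (t := K)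
    (g := Prod.fst)]
  · refine Finset.prod_congr rfl fun k _ => ?_
    have himg : (A k).image (classKey R t)
        = (Finset.univ.image (classKey (P := P) R t)).filter fun g => g.1 = k := by
      ext g
      simp only [hA, Finset.mem_image, Finset.mem_filter, Finset.mem_univ, true_and]
      constructor
      · rintro ⟨s, hs, rfl⟩; exact ⟨⟨s, rfl⟩, hs⟩
      · rintro ⟨⟨s, rfl⟩, hs⟩; exact ⟨s, hs, rfl⟩
    rw [himg]
    refine Finset.prod_congr rfl fun g hg => ?_
    have hgk := (Finset.mem_filter.1 hg).2
    congr 3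
    ext s
    simp only [hA, Finset.mem_filter, Finset.mem_univ, true_and, and_iff_right_iff_imp]
    rintro rfl
    exact hgk
  · intro g hg
    obtain ⟨s, hs, rfl⟩ := Finset.mem_image.1 hg
    exact hmaps s hs

/-- `n ^ n / n!` is one term of the series of `exp n`. -/
theorem natCast_pow_self_le (n : ℕ) : (n : ℝ) ^ n ≤ 3 ^ n * n ! := by
  have h := Real.pow_div_factorial_le_exp (Nat.cast_nonneg n) n (x := (n : ℝ))
  rw [div_le_iff₀ (by positivity)] at h
  have he : Real.exp n ≤ 3 ^ n := by
    rw [← mul_one (n : ℝ), Real.exp_nat_mul]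
    gcongr
    exact Real.exp_one_lt_three.le
  calc (n : ℝ) ^ n ≤ Real.exp n * n ! := h
    _ ≤ 3 ^ n * n ! := by gcongr

/-- Each unit of depth in the pivot tree makes the downdrafts rarer. -/
theorem ncard_OND_mul_pow_le {L : P → P → Prop} (hP : P.Nonempty) (hG : GeneralPosition P)
    (hR : IsRegionSet R) (hL : IsStrictTotalOrder P L) (ht : t.Valid (cell R) P) :
    ((OND P R L).ncard : ℝ) * (6 / 5) ^ t.depthSum P ≤ 3840 ^ P.card * (inputs P R).ncard := by
  classical
  set n := P.card with hn
  set D := t.depthSum P with hD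
  have h1 := factorial_le_inputs hG.injOn_x hR
  have h2 := ncard_OND_mul_le hR hL ht
  have h3 := prod_factorial_cell_le hR ht
  have h4 := natCast_pow_self_le n
  set X := ∏ k ∈ Finset.univ.image fun s : P => cell R s,
    Nat.factorial (Finset.univ.filter fun s : P => cell R s = k).card
  set Y := ∏ k ∈ Finset.univ.image (classKey (P := P) R t),
    Nat.factorial (Finset.univ.filter fun s : P => classKey R t s = k).card with hY
  have hYpos : (0 : ℝ) < Y := by
    rw [hY]; exact_mod_cast Finset.prod_pos fun _ _ => Nat.factorial_pos _
  have h1' : (n ! : ℝ) ≤ (inputs P R).ncard * X := by exact_mod_cast h1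
  have h5 : ((OND P R L).ncard : ℝ) * Y * (3 / 2) ^ D ≤ 4 ^ n * (4 * n) ^ n := by
    calc ((OND P R L).ncard : ℝ) * Y * (3 / 2) ^ D
        ≤ ((∑ a ∈ weights P n, ∏ s : P, ∑ p with t.addr s.1 <+: t.addr p.1, a p : ℕ) : ℝ)
          * (3 / 2) ^ D := by
          gcongr
          exact_mod_cast h2
      _ = ∑ a ∈ weights P n, ((∏ s : P, ∑ p with t.addr s.1 <+: t.addr p.1, a p : ℕ) : ℝ)
          * (3 / 2) ^ D := by
          rw [Nat.cast_sum, Finset.sum_mul]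
      _ ≤ ∑ a ∈ weights P n, (4 * n : ℝ) ^ n :=
          Finset.sum_le_sum fun a ha => prod_load_le hP ht ha
      _ = (weights P n).card * (4 * n : ℝ) ^ n := by rw [Finset.sum_const, nsmul_eq_mul]
      _ ≤ 4 ^ n * (4 * n) ^ n := by
          gcongr
          refine (card_weights_le P n).trans (le_of_eq ?_)
          rw [Fintype.card_coe, ← hn, ← mul_pow]; norm_num
  -- Any bases `b < 2` and `x < 1` with `b * x > 1` would serve: `b / 2 < 1` and `x < 1` make the
  -- two geometric series converge.
  have h6 : (6 / 5 : ℝ) ^ D = (3 / 2) ^ D * (4 / 5) ^ D := by rw [← mul_pow]; norm_num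
  refine le_of_mul_le_mul_right ?_ hYpos
  calc ((OND P R L).ncard : ℝ) * (6 / 5) ^ D * Y
      = ((OND P R L).ncard : ℝ) * Y * (3 / 2) ^ D * (4 / 5) ^ D := by rw [h6]; ring
    _ ≤ 4 ^ n * (4 * n) ^ n * (4 / 5) ^ D := by gcongr
    _ = 16 ^ n * (n : ℝ) ^ n * (4 / 5) ^ D := by
        rw [mul_pow, ← mul_assoc, ← mul_pow]; norm_num
    _ ≤ 16 ^ n * (3 ^ n * n !) * (4 / 5) ^ D := by gcongr
    _ ≤ 16 ^ n * (3 ^ n * ((inputs P R).ncard * X)) * (4 / 5) ^ D := by gcongr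
    _ = 16 ^ n * 3 ^ n * (inputs P R).ncard * (X * (4 / 5) ^ D) := by ring
    _ ≤ 16 ^ n * 3 ^ n * (inputs P R).ncard * (80 ^ n * Y) := by gcongr
    _ = (16 * 3 * 80) ^ n * (inputs P R).ncard * Y := by rw [mul_pow, mul_pow]; ring
    _ = 3840 ^ n * (inputs P R).ncard * Y := by norm_num

theorem depthSum_le {L : (R → Compass) → P → P → Prop} (hP : P.Nonempty)
    (hG : GeneralPosition P) (hR : IsRegionSet R) (hL : ∀ κ, IsAdapted P R κ (L κ))
    (hpos : 0 < ONDmax P R L) (ht : t.Valid (cell R) P) :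
    t.depthSum P * Real.logb 2 (6 / 5) ≤ P.card * Real.logb 2 3840 +
      Real.logb 2 ((inputs P R).ncard / ONDmax P R L) := by
  set B : ℝ := 3840 ^ P.card * (inputs P R).ncard / (6 / 5) ^ t.depthSum P
  have hle : ∀ κ, ((OND P R (L κ)).ncard : ℝ) ≤ B := fun κ =>
    (le_div_iff₀ (by positivity)).2 (ncard_OND_mul_pow_le hP hG hR (hL κ).strictTotal ht)
  have : Nonempty (R → Compass) := ⟨fun _ => .incX⟩
  -- The bound `B` does not depend on `κ`; its floor bounds the supremum, which is taken in `ℕ`.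
  have hmax : (ONDmax P R L : ℝ) ≤ B := by
    refine (Nat.le_floor_iff (by positivity)).1 (ciSup_le fun κ => Nat.le_floor (hle κ))
  have hmpos : (0 : ℝ) < ONDmax P R L := by exact_mod_cast hpos
  rw [le_div_iff₀ (by positivity)] at hmax
  -- An empty universe would force `ONDmax` to vanish by `hmax`.
  have hin : (0 : ℝ) < (inputs P R).ncard := by
    rcases Nat.eq_zero_or_pos (inputs P R).ncard with h | h
    · rw [h] at hmax
      have : 0 < (ONDmax P R L : ℝ) * (6 / 5) ^ t.depthSum P := by positivity
      simp only [Nat.cast_zero, mul_zero] at hmax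
      linarith
    · exact_mod_cast h
  have h : (6 / 5 : ℝ) ^ t.depthSum P ≤ 3840 ^ P.card * ((inputs P R).ncard / ONDmax P R L) := by
    rw [← mul_div_assoc, le_div_iff₀ hmpos]
    linarith
  have h2 := Real.logb_le_logb_of_le (b := 2) (by norm_num) (by positivity) h
  rwa [Real.logb_mul (by positivity) (by positivity), Real.logb_pow, Real.logb_pow] at h2

end bounds

end Pareto

theorem mainTheorem6 :
    ∃ C₁ C₂ : ℝ, 0 < C₁ ∧ 0 < C₂ ∧
      ∀ (P : Finset (ℝ × ℝ)) (R : Set (Set (ℝ × ℝ))),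
        P.Nonempty → Pareto.GeneralPosition P → Pareto.IsRegionSet R →
        ∀ L : (R → Pareto.Compass) → P → P → Prop,
          (∀ κ : R → Pareto.Compass, Pareto.IsAdapted P R κ (L κ)) →
          0 < Pareto.ONDmax P R L →
          ∀ I ∈ Pareto.inputs P R,
            (Pareto.runtime I : ℝ) ≤ C₁ * (P.card : ℝ) +
              C₂ * Real.logb 2 (((Pareto.inputs P R).ncard : ℝ) / (Pareto.ONDmax P R L : ℝ)) := by
  have hlog : 0 < Real.logb 2 (6 / 5) := Real.logb_pos (by norm_num) (by norm_num)
  have hlog' : 0 < Real.logb 2 3840 := Real.logb_pos (by norm_num) (by norm_num)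
  -- The running time is at most `1010 * (D + n) + 30`, and `30 ≤ 30 * n` as `P` is nonempty, whence
  -- 1040; the other terms come from inserting the bound of `depthSum_le` for `D`.
  refine ⟨1040 + 1010 / Real.logb 2 (6 / 5) * Real.logb 2 3840, 1010 / Real.logb 2 (6 / 5),
    by positivity, by positivity, ?_⟩
  intro P R hP hG hR L hL hpos I hI
  have hIP : I.toFinset = P := by
    ext p
    rw [List.mem_toFinset, hI.2.1 p]
  obtain ⟨t, ht, hrun⟩ := Pareto.runtime_le (Pareto.cell R) I hI.1 (hR.exists_sorted hI)
  rw [hIP] at ht hrun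
  rw [t.size_eq] at hrun
  have hdepth := Pareto.depthSum_le hP hG hR hL hpos ht
  have hrun' : (Pareto.runtime I : ℝ) ≤ 1010 * (t.depthSum P + P.card) + 30 := by
    exact_mod_cast hrun
  have hcard : (1 : ℝ) ≤ P.card := by exact_mod_cast hP.card_pos
  rw [← le_div_iff₀ hlog] at hdepth
  calc (Pareto.runtime I : ℝ) ≤ 1010 * t.depthSum P + 1040 * P.card := by linarith
    _ ≤ 1010 * ((P.card * Real.logb 2 3840 + Real.logb 2
          ((Pareto.inputs P R).ncard / Pareto.ONDmax P R L)) / Real.logb 2 (6 / 5))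
          + 1040 * P.card := by gcongr
    _ = _ := by ring
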